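/- Let $(\phi_e)_{e\in\mathbb N}$ be any standard (acceptable) enumeration of the partial computable functions from $\mathbb N$ to $\mathbb N$, let $J$ be the partial computable function with $J(2^e(2x+1))=\phi_e(x)$ for all $e,x$ ($J(0)$ is undefined), and let $q:\mathbb N\to\mathbb N$ be a computable order, i.e. computable, non-decreasing and unbounded. Let $\mathcal{DNC}_q$ be the set of total functions $f:\mathbb N\to\mathbb N$ such that for all $n$: $f(n)\neq J(n)$ (trivially satisfied if $J(n)$ is undefined) and $f(n)<q(n)$. View $\mathcal{DNC}_q$ as a subset of $2^{\mathbb N}$ by writing the values $f(0),f(1),\dots$ one after the other, $f(n)$ in binary with $\lceil\log_2 q(n)\rceil$ digits. (i) Suppose that $\sum_n 1/q(n)<\infty$ and $\mathcal{DNC}_q\neq\emptyset$ (which is automatic if $q(n)\ge 2$ for all $n$). Then $\mathcal{DNC}_q$ is not tt-negligible: there is a computable measure $\mu$ on $2^{\mathbb N}$ with $\mu(\mathcal{DNC}_q)>0$. Moreover, let $X\in 2^{\mathbb N}$ be chosen according to the uniform measure, cut $X$ into consecutive blocks of lengths $\lfloor\log_2 q(n)\rfloor$, $n=0,1,\dots$,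 and let $f_X(n)$ be the number with binary expansion the $n$-th block. Then $f_X\in\mathcal{DNC}_q$ with positive probability. (ii) If $\sum_n 1/q(n)=\infty$, then $\mathcal{DNC}_q$ is deep: it is a $\Pi^0_1$ class and there is a computable order $h$ with $\sum_{\sigma\in T_n}\mathbf M(\sigma)\le 2^{-h(n)}$ for all $n$. Here $T_n$ is the set of strings of length $n$ that are prefixes of members of the class, and $\mathbf M$ is the universal lower semi-computable continuous semi-measure $\mathbf M(\sigma)=\lambda\{X : \widehat\Phi^X\succeq\sigma\}$, where $\lambda$ is the uniform measure on $2^{\mathbb N}$, $(\Phi_e)_{e}$ is an effective enumeration of all Turing functionals, and $\widehat\Phi(1^e0X)=\Phi_e(X)$. -/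

import Mathlib

open MeasureTheory
open scoped ENNReal

namespace DNCDepth

/-! ### Cantor space, the uniform measure, `Π⁰₁` classes -/

/-- The string `X ↾ n` of the first `n` bits of `X ∈ 2^ℕ`. -/
def restrict (X : ℕ → Bool) (n : ℕ) : List Bool := (List.range n).map X

/-- The cylinder `⟦σ⟧` of all sequences that have the prefix `σ`. -/
def cylinder (σ : List Bool) : Set (ℕ → Bool) := {X | restrict X σ.length = σ}

/-- The uniform (Lebesgue) measure `λ` on Cantor space: independent fair bits. -/
noncomputable def uniformMeasure : Measure (ℕ → Bool) :=
  Measure.infinitePi fun _ : ℕ => (PMF.uniformOfFintype Bool).toMeasure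

/-- An order function: non-decreasing and unbounded. -/
def IsOrder (h : ℕ → ℕ) : Prop := Monotone h ∧ ∀ b, ∃ n, b < h n

/-- `C` is a `Π⁰₁` class: its complement is `⟦S⟧` for a c.e. set `S` of strings. -/
def IsPi01 (C : Set (ℕ → Bool)) : Prop :=
  ∃ S : Set (List Bool), REPred (fun σ => σ ∈ S) ∧ Cᶜ = ⋃ σ ∈ S, cylinder σ

/-- The canonical co-c.e. tree of `C`: the strings `σ` with `⟦σ⟧ ∩ C ≠ ∅`. -/
def canonicalTree (C : Set (ℕ → Bool)) : Set (List Bool) :=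
  {σ | (cylinder σ ∩ C).Nonempty}

/-- The `n`-th level `T_n` of a tree `T`. -/
def level (T : Set (List Bool)) (n : ℕ) : Set (List Bool) := {σ | σ ∈ T ∧ σ.length = n}

/-! ### Turing functionals and the universal continuous semi-measure -/

/-- Comparable inputs are sent to comparable outputs. -/
def IsConsistent (Φ : Set (List Bool × List Bool)) : Prop :=
  ∀ p ∈ Φ, ∀ p' ∈ Φ, p.1 <+: p'.1 → p.2 <+: p'.2 ∨ p'.2 <+: p.2

/-- A Turing functional: a consistent c.e. set of pairs of strings. -/
def IsTuringFunctional (Φ : Set (List Bool × List Bool)) : Prop :=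
  REPred (fun p => p ∈ Φ) ∧ IsConsistent Φ

/-- The (finite) set of pairs that the `e`-th program accepts within `k` steps. -/
def enumStage (e k : ℕ) : Set (List Bool × List Bool) :=
  {p | (Nat.Partrec.Code.evaln k (Nat.Partrec.Code.ofNatCode e) (Encodable.encode p)).isSome}

/-- The effective list `(Φ_e)` of all Turing functionals: `Φ_e` enumerates the `e`-th c.e. set of
pairs of strings for as long as it stays consistent. -/
def functional (e : ℕ) : Set (List Bool × List Bool) :=
  {p | ∃ k, p ∈ enumStage e k ∧ IsConsistent (enumStage e k)}

theorem enumStage_mono (e : ℕ) {k l : ℕ} (h : k ≤ l) : enumStage e k ⊆ enumStage e l := by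
  intro p hp
  simp only [enumStage, Set.mem_ofPred_eq, Option.isSome_iff_exists] at hp ⊢
  obtain ⟨x, hx⟩ := hp
  exact ⟨x, Nat.Partrec.Code.evaln_mono h hx⟩

/-- Each `Φ_e` is consistent. -/
theorem functional_consistent (e : ℕ) : IsConsistent (functional e) := by
  rintro p ⟨k, hpk, hk⟩ p' ⟨l, hpl, hl⟩ h
  rcases le_total k l with hkl | hkl
  · exact hl p (enumStage_mono e hkl hpk) p' hpl h
  · exact hk p hpk p' (enumStage_mono e hkl hpl) h

/-- Each Turing functional occurs in the list. -/
theorem exists_functional_eq {Φ : Set (List Bool × List Bool)} (hΦ : IsTuringFunctional Φ) :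
    ∃ e, functional e = Φ := by
  obtain ⟨hre, hcons⟩ := hΦ
  obtain ⟨c, hc⟩ := Nat.Partrec.Code.exists_code.1 hre
  have key : ∀ p, p ∈ Φ ↔ ∃ k, p ∈ enumStage (Nat.Partrec.Code.encodeCode c) k := by
    intro p
    have hdom : (c.eval (Encodable.encode p)).Dom ↔ p ∈ Φ := by
      rw [hc]
      simp [Part.assert, Part.bind]
    have hcode : Nat.Partrec.Code.ofNatCode (Nat.Partrec.Code.encodeCode c) = c :=
      Denumerable.ofNat_encode c
    rw [← hdom]
    simp only [enumStage, Set.mem_ofPred_eq, hcode, Option.isSome_iff_exists]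
    constructor
    · intro h
      obtain ⟨k, hk⟩ := Nat.Partrec.Code.evaln_complete.1 (Part.get_mem h)
      exact ⟨k, _, hk⟩
    · rintro ⟨k, x, hx⟩
      exact Part.dom_iff_mem.2 ⟨x, Nat.Partrec.Code.evaln_sound hx⟩
  refine ⟨Nat.Partrec.Code.encodeCode c, Set.ext fun p => ⟨?_, ?_⟩⟩
  · rintro ⟨k, hk, -⟩
    exact (key p).2 ⟨k, hk⟩
  · intro hp
    obtain ⟨k, hk⟩ := (key p).1 hp
    exact ⟨k, hk, fun a ha b hb => hcons a ((key a).2 ⟨k, ha⟩) b ((key b).2 ⟨k, hb⟩)⟩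

/-- The universal Turing functional `Φ̂`, with `Φ̂(1^e 0 X) = Φ_e(X)`. -/
def universalFunctional : Set (List Bool × List Bool) :=
  {p | ∃ e α, p.1 = List.replicate e true ++ false :: α ∧ (α, p.2) ∈ functional e}

/-- `Φ^X ⪰ σ`. (With no pair that applies to `X` the output `Φ^X` is the empty string.) -/
def OutputExtends (Φ : Set (List Bool × List Bool)) (X : ℕ → Bool) (σ : List Bool) : Prop :=
  σ = [] ∨ ∃ n τ, (restrict X n, τ) ∈ Φ ∧ σ <+: τ

/-- The universal lower semi-computable continuous semi-measure (a priori probability)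
`M(σ) = λ {X | Φ̂^X ⪰ σ}`. -/
noncomputable def aprioriM (σ : List Bool) : ℝ≥0∞ :=
  uniformMeasure {X | OutputExtends universalFunctional X σ}

/-- `C` is a deep `Π⁰₁` class: `M(T_n) = ∑_{σ ∈ T_n} M(σ)` is at most `2^{-h(n)}` for a computable
order `h`, where `T` is the canonical co-c.e. tree of `C`. The inequality is not strict: at the root
`M` has the value `1`, so that `n = 0` would exclude every non-empty class. -/
def IsDeep (C : Set (ℕ → Bool)) : Prop :=
  IsPi01 C ∧ ∃ h : ℕ → ℕ, Computable h ∧ IsOrder h ∧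
    ∀ n, ∑' σ : level (canonicalTree C) n, aprioriM σ ≤ (2 : ℝ≥0∞)⁻¹ ^ h n

/-! ### Computable measures and tt-negligibility -/

/-- A measure on Cantor space is computable if some computable function yields, for a string `σ`
and a precision `i`, a dyadic rational `a / 2^b` within `2^{-i}` of the measure of `⟦σ⟧`. -/
def IsComputableMeasure (μ : Measure (ℕ → Bool)) : Prop :=
  ∃ a : List Bool × ℕ → ℕ × ℕ, Computable a ∧
    ∀ σ i, |μ.real (cylinder σ) - ((a (σ, i)).1 : ℝ) / 2 ^ (a (σ, i)).2| ≤ (1 / 2 : ℝ) ^ i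

/-- `C` is tt-negligible: `μ(C) = 0` for every computable measure `μ`. -/
def IsTTNegligible (C : Set (ℕ → Bool)) : Prop :=
  ∀ μ : Measure (ℕ → Bool), IsFiniteMeasure μ → IsComputableMeasure μ → μ C = 0

/-! ### Diagonally non-computable functions -/

/-- A standard (acceptable) enumeration `(φ_e)` of the partial computable functions on `ℕ`: it is
uniformly partial computable, and every uniformly partial computable sequence of functions
translates into it computably. -/
def IsStandardEnumeration (φ : ℕ → ℕ →. ℕ) : Prop :=
  Partrec₂ φ ∧ ∀ ψ : ℕ → ℕ →. ℕ, Partrec₂ ψ → ∃ f : ℕ → ℕ, Computable f ∧ ∀ i, φ (f i) = ψ i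

/-- Program codes give a standard enumeration. -/
theorem isStandardEnumeration_code :
    IsStandardEnumeration fun e => (Denumerable.ofNat Nat.Partrec.Code e).eval := by
  refine ⟨?_, fun ψ hψ => ?_⟩
  · exact Nat.Partrec.Code.eval_part.comp₂ ((Computable.ofNat _).comp Computable.fst) Computable.snd
  · have h : Partrec fun m : ℕ => ψ m.unpair.1 m.unpair.2 :=
      hψ.comp (Computable.fst.comp Computable.unpair) (Computable.snd.comp Computable.unpair)
    obtain ⟨c, hc⟩ := Nat.Partrec.Code.exists_code.1 (Partrec.nat_iff.1 h)
    refine ⟨fun i => Encodable.encode (Nat.Partrec.Code.curry c i), ?_, fun i => ?_⟩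
    · exact Computable.encode.comp (Nat.Partrec.Code.primrec₂_curry.to_comp.comp
        (Computable.const c) Computable.id)
    · funext x
      simp [Nat.Partrec.Code.eval_curry, hc]

/-- The universal partial computable function `J(2^e (2x+1)) = φ_e(x)`, undefined at `0`. -/
def J (φ : ℕ → ℕ →. ℕ) : ℕ →. ℕ := fun n =>
  if n = 0 then Part.none else φ (padicValNat 2 n) (n / 2 ^ (padicValNat 2 n + 1))

theorem J_zero (φ : ℕ → ℕ →. ℕ) : J φ 0 = Part.none := by simp [J]

theorem J_apply (φ : ℕ → ℕ →. ℕ) (e x : ℕ) : J φ (2 ^ e * (2 * x + 1)) = φ e x := by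
  have h : padicValNat 2 (2 ^ e * (2 * x + 1)) = e := by
    rw [padicValNat.mul (by positivity) (by positivity), padicValNat.prime_pow,
      padicValNat.eq_zero_of_not_dvd (by omega), add_zero]
  have h2 : 2 ^ e * (2 * x + 1) / 2 ^ (e + 1) = x := by
    rw [pow_succ, Nat.mul_div_mul_left _ _ (by positivity)]
    omega
  have h0 : 2 ^ e * (2 * x + 1) ≠ 0 := by positivity
  simp only [J, h, h2, if_neg h0]

/-- `DNC_q ⊆ ℕ^ℕ`: the functions `f` with `f(n) ≠ J(n)` (trivially true if `J(n)` is undefined) and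
`f(n) < q(n)` for all `n`. -/
def DNC (φ : ℕ → ℕ →. ℕ) (q : ℕ → ℕ) : Set (ℕ → ℕ) :=
  {f | ∀ n, f n ∉ J φ n ∧ f n < q n}

/-- Split `ℕ` into consecutive intervals `I_0, I_1, …` of lengths `r 0, r 1, …`; then `decode r X` is
the function that sends `n` to the index of `X ↾ I_n` in the lexicographic order of the strings of
length `r n`, that is, the number whose `r n`-digit binary expansion is `X ↾ I_n`. -/
def decode (r : ℕ → ℕ) (X : ℕ → Bool) (n : ℕ) : ℕ :=
  ∑ i ∈ Finset.range (r n),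
    (X ((∑ j ∈ Finset.range n, r j) + i)).toNat * 2 ^ (r n - 1 - i)

/-- `DNC_q` as a subset of Cantor space: `f` is coded by writing each `f(n)` in binary with
`⌈log₂ q(n)⌉` digits. -/
def DNCClass (φ : ℕ → ℕ →. ℕ) (q : ℕ → ℕ) : Set (ℕ → Bool) :=
  {X | decode (fun n => Nat.clog 2 (q n)) X ∈ DNC φ q}

end DNCDepth

namespace DNCDepth

/-! ### Computable and computably enumerable predicates -/

section RE

variable {α β γ : Type*} [Primcodable α] [Primcodable β] [Primcodable γ]

/-! (i) Let t(n) = ⌊log₂ q(n)⌋. A block of t(n) fair bits gives a number below 2^t(n) ≤ q(n), and it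
hits J(n), if that is defined, with probability at most 2^(-t(n)) < 2/q(n). By convergence, the
failures at n ≥ N have total probability below 1 for some N. Fixing the first N blocks at admissible
values is an event E of positive probability, independent of the later blocks, so by the union bound
the failures do not exhaust E. In the coding with ⌈log₂ q(n)⌉ digits, a block has at most one digit
more than t(n); letting this leading digit be constantly 0 gives a computable product measure. Both
claims are instances of `paddedMeasure_DNC_pos`.

(ii) By the recursion theorem some φ_e knows its index e, hence the nodes 2^e(2x+1) at which it
determines J. The arguments x are split among the thresholds k, and the j-th attack on the threshold
k has its own node n_j. There φ_e waits for a value v such that, with probability more than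
2^(-k)/q(n_j), the output of the universal functional has value v at n_j and has avoided φ_e at the
earlier nodes; then φ_e takes this value and kills those outputs (`exists_killing_index`). Suppose
that outputs with probability more than 2^(-k) survive the first m attacks. By the pigeonhole
principle among q(n_j) values each of these attacks finds its v. The killed events are disjoint and
their probabilities add up to more than 2^(-k) ∑_{j<m} 1/q(n_j), which is impossible once the sum
reaches 2^k (`exists_survivorSet_small`). For fixed e and k the nodes form an arithmetic
progression, so the sum diverges by monotonicity of q (`not_summable_attackNode`), and a sufficient
m = m(k) can be computed. Every string on a level of the canonical tree that covers these nodes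
decodes to a survivor, so the level has measure at most 2^(-k); inverting the level as a function of
k yields the order h. -/

theorem computablePred_comp {p : β → Prop} (hp : ComputablePred p) {f : α → β}
    (hf : Computable f) : ComputablePred fun a => p (f a) := by
  obtain ⟨_, h⟩ := hp
  exact ⟨fun a => inferInstance, h.comp hf⟩

theorem computablePred_rel {R : β → γ → Prop} (hR : PrimrecRel R) {f : α → β} {g : α → γ}
    (hf : Computable f) (hg : Computable g) : ComputablePred fun a => R (f a) (g a) := by
  obtain ⟨_, h⟩ := hR
  exact ⟨fun a => inferInstanceAs (Decidable ((fun p : β × γ => R p.1 p.2) (f a, g a))),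
    h.to_comp.comp (hf.pair hg)⟩

theorem computablePred_eq {f g : α → β} (hf : Computable f) (hg : Computable g) :
    ComputablePred fun a => f a = g a := by
  classical exact computablePred_rel Primrec.eq hf hg

theorem computablePred_le {f g : α → ℕ} (hf : Computable f) (hg : Computable g) :
    ComputablePred fun a => f a ≤ g a := computablePred_rel Primrec.nat_le hf hg

theorem computablePred_lt {f g : α → ℕ} (hf : Computable f) (hg : Computable g) :
    ComputablePred fun a => f a < g a := computablePred_rel Primrec.nat_lt hf hg

theorem computablePred_and {p p' : α → Prop} (hp : ComputablePred p) (hp' : ComputablePred p') :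
    ComputablePred fun a => p a ∧ p' a := by
  obtain ⟨_, h⟩ := hp
  obtain ⟨_, h'⟩ := hp'
  exact ⟨fun a => inferInstance, (Primrec.and.to_comp.comp h h').of_eq fun a => by simp⟩

theorem computablePred_or {p p' : α → Prop} (hp : ComputablePred p) (hp' : ComputablePred p') :
    ComputablePred fun a => p a ∨ p' a := by
  obtain ⟨_, h⟩ := hp
  obtain ⟨_, h'⟩ := hp'
  exact ⟨fun a => inferInstance, (Primrec.or.to_comp.comp h h').of_eq fun a => by simp⟩

theorem computable_ite {p : α → Prop} [DecidablePred p] (hp : ComputablePred p) {f g : α → β}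
    (hf : Computable f) (hg : Computable g) : Computable fun a => if p a then f a else g a :=
  (Computable.cond hp.decide hf hg).of_eq fun a => by by_cases h : p a <;> simp [h]

/-- The values of a function with decidable graph can be found by search. -/
theorem computable_of_graph {f : α → ℕ} (h : ComputablePred fun p : α × ℕ => f p.1 = p.2) :
    Computable f := by
  obtain ⟨_, h⟩ := h
  have h2 : Computable₂ fun (a : α) (n : ℕ) => decide ((fun p : α × ℕ => f p.1 = p.2) (a, n)) :=
    h.to₂
  refine (Partrec.rfind h2.partrec₂).of_eq_tot fun a => ?_
  rw [Nat.mem_rfind]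
  refine ⟨by simp, fun {m} hm => by simp; omega⟩

/-- A computable predicate that always has a witness has a computable choice of witnesses. -/
theorem exists_computable_witness {p : α → ℕ → Prop} (hp : ComputablePred fun x : α × ℕ => p x.1 x.2)
    (h : ∀ a, ∃ n, p a n) : ∃ f : α → ℕ, Computable f ∧ ∀ a, p a (f a) := by
  classical
  refine ⟨fun a => Nat.find (h a), ?_, fun a => Nat.find_spec (h a)⟩
  refine (Partrec.rfind (p := fun a n => Part.some (decide (p a n)))
    (Computable₂.partrec₂ hp.decide.to₂)).of_eq_tot fun a => ?_
  exact Nat.mem_rfind.2 ⟨by simpa using Nat.find_spec (h a),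
    fun {m} hm => by simpa using Nat.find_min (h a) hm⟩

theorem computable_sum {f : α → ℕ → ℕ} (hf : Computable₂ f) {n : α → ℕ} (hn : Computable n) :
    Computable fun a => ∑ i ∈ Finset.range (n a), f a i := by
  refine (Computable.nat_rec (h := fun a (p : ℕ × ℕ) => p.2 + f a p.1) hn (Computable.const 0)
    (Primrec.nat_add.to_comp.comp (Computable.snd.comp Computable.snd)
      (hf.comp Computable.fst (Computable.fst.comp Computable.snd)))).of_eq fun a => ?_
  induction n a with
  | zero => simp
  | succ k ih => rw [Finset.sum_range_succ, ← ih]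

theorem computable_prod {f : α → ℕ → ℕ} (hf : Computable₂ f) {n : α → ℕ} (hn : Computable n) :
    Computable fun a => ∏ i ∈ Finset.range (n a), f a i := by
  refine (Computable.nat_rec (h := fun a (p : ℕ × ℕ) => p.2 * f a p.1) hn (Computable.const 1)
    (Primrec.nat_mul.to_comp.comp (Computable.snd.comp Computable.snd)
      (hf.comp Computable.fst (Computable.fst.comp Computable.snd)))).of_eq fun a => ?_
  induction n a with
  | zero => simp
  | succ k ih => rw [Finset.prod_range_succ, ← ih]

theorem computable_two_pow {f : α → ℕ} (hf : Computable f) : Computable fun a => 2 ^ f a := by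
  have := computable_prod (f := fun _ _ => 2) (Computable.const 2).to₂ hf
  exact this.of_eq fun a => by simp

theorem computablePred_exists_lt {p : α → ℕ → Prop}
    (hp : ComputablePred fun x : α × ℕ => p x.1 x.2) {n : α → ℕ} (hn : Computable n) :
    ComputablePred fun a => ∃ i < n a, p a i := by
  classical
  have h : Computable fun a => ∑ i ∈ Finset.range (n a), if p a i then 1 else 0 :=
    computable_sum (f := fun a i => if p a i then 1 else 0)
      (computable_ite hp (Computable.const 1) (Computable.const 0)).to₂ hn
  refine (computablePred_lt (Computable.const 0) h).of_eq fun a => ?_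
  simp [Finset.filter_nonempty_iff]

theorem computablePred_forall_lt {p : α → ℕ → Prop}
    (hp : ComputablePred fun x : α × ℕ => p x.1 x.2) {n : α → ℕ} (hn : Computable n) :
    ComputablePred fun a => ∀ i < n a, p a i := by
  refine (computablePred_exists_lt (p := fun a i => ¬ p a i) hp.not hn).not.of_eq fun a => ?_
  push Not
  rfl

theorem computable_findGreatest {p : α → ℕ → Prop} [∀ a, DecidablePred (p a)]
    (hp : ComputablePred fun x : α × ℕ => p x.1 x.2) {n : α → ℕ} (hn : Computable n) :
    Computable fun a => Nat.findGreatest (p a) (n a) := by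
  refine (Computable.nat_rec (f := n) (g := fun _ => 0)
    (h := fun a (x : ℕ × ℕ) => if p a (x.1 + 1) then x.1 + 1 else x.2)
    hn (Computable.const 0) ?_).of_eq fun a => ?_
  · have h1 : Computable fun y : α × ℕ × ℕ => y.2.1 + 1 :=
      Computable.succ.comp (Computable.fst.comp Computable.snd)
    have h2 := computablePred_comp hp (Computable.fst.pair h1)
    exact (computable_ite (p := fun y : α × ℕ × ℕ => p y.1 (y.2.1 + 1)) h2 h1
      (Computable.snd.comp Computable.snd)).to₂
  · induction n a with
    | zero => simp
    | succ k ih => rw [Nat.findGreatest_succ, ← ih]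

/-- Enumeration in stages. -/
theorem exists_stage_of_rePred {p : α → Prop} (hp : REPred p) :
    ∃ f : α → ℕ → Bool, Primrec₂ f ∧ (∀ a s t, s ≤ t → f a s = true → f a t = true) ∧
      ∀ a, p a ↔ ∃ s, f a s = true := by
  obtain ⟨c, hc⟩ := Nat.Partrec.Code.exists_code.1 hp
  refine ⟨fun a s => (Nat.Partrec.Code.evaln s c (Encodable.encode a)).isSome, ?_, ?_, fun a => ?_⟩
  · exact Primrec.option_isSome.comp (Nat.Partrec.Code.primrec_evaln.comp
      ((Primrec.snd.pair (Primrec.const c)).pair (Primrec.encode.comp Primrec.fst)))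
  · intro a s t hst h
    obtain ⟨x, hx⟩ := Option.isSome_iff_exists.1 h
    exact Option.isSome_iff_exists.2 ⟨x, Nat.Partrec.Code.evaln_mono hst hx⟩
  · have hdom : (c.eval (Encodable.encode a)).Dom ↔ p a := by
      rw [hc]
      simp [Part.assert, Part.bind]
    rw [← hdom]
    simp only [Option.isSome_iff_exists]
    constructor
    · intro h
      obtain ⟨k, hk⟩ := Nat.Partrec.Code.evaln_complete.1 (Part.get_mem h)
      exact ⟨k, _, hk⟩
    · rintro ⟨k, x, hx⟩
      exact Part.dom_iff_mem.2 ⟨x, Nat.Partrec.Code.evaln_sound hx⟩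

theorem rePred_of_stage {f : α → ℕ → Bool} (hf : Computable₂ f) :
    REPred fun a => ∃ s, f a s = true := by
  refine (Partrec.rfind hf.partrec₂).dom_re.of_eq fun a => ?_
  simp [Nat.rfind_dom]

theorem rePred_comp {p : β → Prop} (hp : REPred p) {f : α → β} (hf : Computable f) :
    REPred fun a => p (f a) := by
  obtain ⟨g, hg, -, h⟩ := exists_stage_of_rePred hp
  exact (rePred_of_stage (f := fun a s => g (f a) s)
    (hg.to_comp.comp (hf.comp Computable.fst) Computable.snd)).of_eq fun a => (h _).symm

theorem rePred_exists {p : α → β → Prop} (hp : REPred fun x : α × β => p x.1 x.2) :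
    REPred fun a => ∃ b, p a b := by
  obtain ⟨g, hg, hm, h⟩ := exists_stage_of_rePred hp
  -- The search runs over pairs of a code for `b` and a stage; numbers that code no element are
  -- rejected.
  have hc : Computable₂ fun (a : α) (s : ℕ) =>
      Option.casesOn (motive := fun _ => Bool) (Encodable.decode (α := β) s.unpair.1) false
        (fun b => g (a, b) s.unpair.2) := by
    refine Computable.option_casesOn
      (o := fun x : α × ℕ => Encodable.decode (α := β) x.2.unpair.1) (f := fun _ => false)
      (g := fun (x : α × ℕ) (b : β) => g (x.1, b) x.2.unpair.2) ?_ (Computable.const _) ?_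
    · exact Computable.decode.comp
        (Computable.fst.comp (Computable.unpair.comp Computable.snd))
    · exact hg.to_comp.comp ((Computable.fst.comp Computable.fst).pair Computable.snd)
        (Computable.snd.comp (Computable.unpair.comp (Computable.snd.comp Computable.fst)))
  refine (rePred_of_stage hc).of_eq fun a => ?_
  constructor
  · rintro ⟨s, hs⟩
    cases hd : Encodable.decode (α := β) s.unpair.1 with
    | none => simp [hd] at hs
    | some b => exact ⟨b, (h (a, b)).2 ⟨_, by simpa [hd] using hs⟩⟩
  · rintro ⟨b, hb⟩
    obtain ⟨s, hs⟩ := (h (a, b)).1 hb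
    exact ⟨Nat.pair (Encodable.encode b) s, by simpa using hs⟩

theorem rePred_and {p p' : α → Prop} (hp : REPred p) (hp' : REPred p') :
    REPred fun a => p a ∧ p' a := by
  obtain ⟨g, hg, hm, h⟩ := exists_stage_of_rePred hp
  obtain ⟨g', hg', hm', h'⟩ := exists_stage_of_rePred hp'
  refine (rePred_of_stage (f := fun a s => g a s && g' a s)
    (Primrec.and.comp hg hg').to_comp).of_eq fun a => ?_
  rw [h, h']
  constructor
  · rintro ⟨s, hs⟩
    rw [Bool.and_eq_true] at hs
    exact ⟨⟨s, hs.1⟩, s, hs.2⟩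
  · rintro ⟨⟨s, hs⟩, t, ht⟩
    exact ⟨max s t, by simp [hm a s _ (le_max_left s t) hs, hm' a t _ (le_max_right s t) ht]⟩

theorem rePred_or {p p' : α → Prop} (hp : REPred p) (hp' : REPred p') :
    REPred fun a => p a ∨ p' a := by
  obtain ⟨g, hg, hm, h⟩ := exists_stage_of_rePred hp
  obtain ⟨g', hg', hm', h'⟩ := exists_stage_of_rePred hp'
  refine (rePred_of_stage (f := fun a s => g a s || g' a s)
    (Primrec.or.comp hg hg').to_comp).of_eq fun a => ?_
  rw [h, h', ← exists_or]
  simp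

theorem rePred_forall_lt {p : α → ℕ → Prop} (hp : REPred fun x : α × ℕ => p x.1 x.2) {n : α → ℕ}
    (hn : Computable n) : REPred fun a => ∀ i < n a, p a i := by
  obtain ⟨g, hg, hm, h⟩ := exists_stage_of_rePred hp
  have hc : ComputablePred fun x : α × ℕ => ∀ i < n x.1, g (x.1, i) x.2 = true := by
    refine computablePred_forall_lt (p := fun x i => g (x.1, i) x.2 = true)
      (computablePred_eq ?_ (Computable.const true)) (hn.comp Computable.fst)
    exact hg.to_comp.comp ((Computable.fst.comp Computable.fst).pair Computable.snd)
      (Computable.snd.comp Computable.fst)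
  refine (rePred_exists (p := fun a s => ∀ i < n a, g (a, i) s = true) hc.to_re).of_eq fun a => ?_
  constructor
  · rintro ⟨s, hs⟩ i hi
    exact (h (a, i)).2 ⟨s, hs i hi⟩
  · intro H
    have : ∀ i, ∃ s, i < n a → g (a, i) s = true := fun i => by
      by_cases hi : i < n a
      · obtain ⟨s, hs⟩ := (h (a, i)).1 (H i hi)
        exact ⟨s, fun _ => hs⟩
      · exact ⟨0, fun h => absurd h hi⟩
    -- Finitely many stages have a common upper bound, for which their sum is taken.
    choose s hs using this
    exact ⟨∑ i ∈ Finset.range (n a), s i, fun i hi => hm _ _ _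
      (Finset.single_le_sum (f := s) (fun _ _ => Nat.zero_le _) (Finset.mem_range.2 hi)) (hs i hi)⟩

/-- The graph of a partial computable function is c.e. -/
theorem rePred_mem {f : α → β →. ℕ} (hf : Partrec₂ f) :
    REPred fun x : α × β × ℕ => x.2.2 ∈ f x.1 x.2.1 := by
  have h1 : Partrec fun x : α × β × ℕ => f x.1 x.2.1 :=
    hf.comp Computable.fst (Computable.fst.comp Computable.snd)
  have h2 : Computable fun z : (α × β × ℕ) × ℕ => decide (z.2 = z.1.2.2) :=
    (computablePred_eq Computable.snd
      (Computable.snd.comp (Computable.snd.comp Computable.fst))).decide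
  have h3 : Computable₂ fun (z : (α × β × ℕ) × ℕ) (_ : ℕ) => decide (z.2 = z.1.2.2) :=
    h2.comp Computable.fst
  -- The inner search ignores its variable: it stops at once if the computed value is the required
  -- one and diverges otherwise.
  have key : ∀ x : α × β × ℕ, ((f x.1 x.2.1).bind fun y =>
      Nat.rfind fun _ => Part.some (decide (y = x.2.2))).Dom ↔ x.2.2 ∈ f x.1 x.2.1 := by
    intro x
    rw [Part.dom_iff_mem]
    constructor
    · rintro ⟨z, hz⟩
      obtain ⟨y, hy, hz⟩ := Part.mem_bind_iff.1 hz
      have h : y = x.2.2 := by simpa using (Nat.mem_rfind.1 hz).1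
      exact h ▸ hy
    · intro h
      exact ⟨0, Part.mem_bind_iff.2 ⟨_, h, Nat.mem_rfind.2 ⟨by simp, by simp⟩⟩⟩
  have h4 := (h1.bind (Partrec.rfind h3.partrec₂).to₂).dom_re
  exact h4.of_eq key

/-- Uniformization of a c.e. relation by a partial computable function. -/
theorem exists_partrec_selector {R : α → ℕ → Prop} (hR : REPred fun x : α × ℕ => R x.1 x.2) :
    ∃ f : α →. ℕ, Partrec f ∧ (∀ a, ∀ v ∈ f a, R a v) ∧ ∀ a, (∃ v, R a v) → (f a).Dom := by
  obtain ⟨g, hg, hm, h⟩ := exists_stage_of_rePred hR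
  -- A search through pairs of a value and a stage returns the value that is confirmed first.
  have hc : Computable₂ fun (a : α) (s : ℕ) =>
      (bif g (a, s.unpair.1) s.unpair.2 then some s.unpair.1 else none : Option ℕ) := by
    have h1 : Computable fun x : α × ℕ => x.2.unpair.1 :=
      Computable.fst.comp (Computable.unpair.comp Computable.snd)
    have h2 : Computable fun x : α × ℕ => x.2.unpair.2 :=
      Computable.snd.comp (Computable.unpair.comp Computable.snd)
    exact Computable.cond (hg.to_comp.comp (Computable.fst.pair h1) h2)
      (Computable.option_some.comp h1) (Computable.const none)
  refine ⟨_, Partrec.rfindOpt hc, fun a v hv => ?_, fun a ⟨v, hv⟩ => ?_⟩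
  · obtain ⟨s, hs⟩ := Nat.rfindOpt_spec hv
    cases hb : g (a, s.unpair.1) s.unpair.2 with
    | false => simp [hb] at hs
    | true =>
      simp only [hb, cond_true, Option.mem_def, Option.some.injEq] at hs
      exact hs ▸ (h (a, s.unpair.1)).2 ⟨_, hb⟩
  · obtain ⟨s, hs⟩ := (h (a, v)).1 hv
    exact Nat.rfindOpt_dom.2 ⟨Nat.pair v s, v, by simp [hs]⟩

end RE

/-- Rogers' fixed point theorem for a standard enumeration. -/
theorem IsStandardEnumeration.fixed_point {φ : ℕ → ℕ →. ℕ} (hφ : IsStandardEnumeration φ)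
    {ψ : ℕ → ℕ →. ℕ} (hψ : Partrec₂ ψ) : ∃ e, φ e = ψ e := by
  obtain ⟨hp, ht⟩ := hφ
  -- `d u` is an index of φ_{φ_u(u)}, and `f 0` is an index of the function `g`. At u = `f 0` this
  -- gives φ_{d u} = φ_{g u} = ψ_{d u}.
  have hdiag : Partrec₂ fun u x : ℕ => (φ u u).bind fun y => φ y x := by
    have h1 : Partrec fun p : ℕ × ℕ => φ p.1 p.1 := hp.comp Computable.fst Computable.fst
    exact h1.bind (hp.comp Computable.snd (Computable.snd.comp Computable.fst)).to₂
  obtain ⟨d, hd, hdφ⟩ := ht _ hdiag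
  obtain ⟨g, hg, hgφ⟩ := ht (fun i x => ψ (d i) x)
    (hψ.comp (hd.comp Computable.fst) Computable.snd)
  obtain ⟨f, -, hfφ⟩ := ht (fun _ x => Part.some (g x)) (hg.comp Computable.snd).partrec
  refine ⟨d (f 0), ?_⟩
  refine (hdφ _).trans (Eq.trans ?_ (hgφ (f 0)))
  funext x
  simp [hfφ 0]

/-! ### Cylinders -/

theorem restrict_length (X : ℕ → Bool) (n : ℕ) : (restrict X n).length = n := by simp [restrict]

theorem restrict_mem_cylinder (X : ℕ → Bool) (n : ℕ) : X ∈ cylinder (restrict X n) := by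
  simp [cylinder, restrict_length]

theorem mem_cylinder_iff {X : ℕ → Bool} {σ : List Bool} :
    X ∈ cylinder σ ↔ ∀ i < σ.length, X i = σ.getD i false := by
  rw [cylinder, Set.mem_ofPred_eq]
  constructor
  · intro h i hi
    rw [← h]
    simp [restrict, hi]
  · intro h
    refine List.ext_getElem (restrict_length _ _) fun i hi hi' => ?_
    have := h i hi'
    simpa [restrict, hi'] using this

theorem restrict_take (X : ℕ → Bool) {m n : ℕ} (h : m ≤ n) :
    (restrict X n).take m = restrict X m := by
  simp [restrict, ← List.map_take, List.take_range, h]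

theorem restrict_prefix (X : ℕ → Bool) {m n : ℕ} (h : m ≤ n) : restrict X m <+: restrict X n := by
  rw [← restrict_take X h]
  exact List.take_prefix _ _

theorem restrict_comparable (X : ℕ → Bool) (m n : ℕ) :
    restrict X m <+: restrict X n ∨ restrict X n <+: restrict X m :=
  (le_total m n).imp (restrict_prefix X) (restrict_prefix X)

/-! ### Product measures with constant and fair bits -/

/-- Independent bits: the bit `i` is constantly `0` if `P i` holds and fair otherwise. -/
noncomputable def paddedMeasure (P : ℕ → Bool) : Measure (ℕ → Bool) :=
  Measure.infinitePi fun i => bif P i then Measure.dirac false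
    else (PMF.uniformOfFintype Bool).toMeasure

instance paddedFactor_isProbability (b : Bool) : IsProbabilityMeasure
    (bif b then Measure.dirac false else (PMF.uniformOfFintype Bool).toMeasure) := by
  cases b <;> simp only [cond_true, cond_false] <;> infer_instance

instance (P : ℕ → Bool) : IsProbabilityMeasure (paddedMeasure P) := by
  unfold paddedMeasure
  infer_instance

theorem uniformMeasure_eq_paddedMeasure : uniformMeasure = paddedMeasure fun _ => false := rfl

instance : IsProbabilityMeasure uniformMeasure :=
  inferInstanceAs (IsProbabilityMeasure (paddedMeasure fun _ => false))

theorem paddedFactor_singleton (b c : Bool) :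
    (bif b then Measure.dirac false else (PMF.uniformOfFintype Bool).toMeasure) {c} =
      bif b then (bif c then 0 else 1) else (2 : ℝ≥0∞)⁻¹ := by
  cases b
  · rw [cond_false, cond_false, PMF.toMeasure_apply_singleton _ _ (measurableSet_singleton c)]
    simp
  · cases c <;> simp

theorem paddedMeasure_box (P : ℕ → Bool) (I : Finset ℕ) (τ : ℕ → Bool) :
    paddedMeasure P {X | ∀ i ∈ I, X i = τ i} =
      ∏ i ∈ I, bif P i then (bif τ i then 0 else 1) else (2 : ℝ≥0∞)⁻¹ := by
  have h := Measure.infinitePi_pi (fun i => bif P i then Measure.dirac false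
    else (PMF.uniformOfFintype Bool).toMeasure) (s := I) (t := fun i => {τ i})
    fun i _ => measurableSet_singleton _
  simp only [paddedFactor_singleton] at h
  rw [← h]
  rfl

theorem measurableSet_box (I : Finset ℕ) (τ : ℕ → Bool) :
    MeasurableSet {X : ℕ → Bool | ∀ i ∈ I, X i = τ i} :=
  MeasurableSet.pi (s := (I : Set ℕ)) (t := fun i => {τ i}) I.countable_toSet
    fun _ _ => measurableSet_singleton _

theorem cylinder_eq_box (σ : List Bool) :
    cylinder σ = {X | ∀ i ∈ Finset.range σ.length, X i = σ.getD i false} := by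
  ext X
  simp only [mem_cylinder_iff, Finset.mem_range, Set.mem_ofPred_eq]

theorem measurableSet_cylinder (σ : List Bool) : MeasurableSet (cylinder σ) := by
  rw [cylinder_eq_box]
  exact measurableSet_box _ _

theorem uniformMeasure_cylinder (σ : List Bool) :
    uniformMeasure (cylinder σ) = (2 : ℝ≥0∞)⁻¹ ^ σ.length := by
  rw [cylinder_eq_box, uniformMeasure_eq_paddedMeasure, paddedMeasure_box]
  simp

theorem measurableSet_exists_restrict (p : List Bool → Prop) :
    MeasurableSet {X | ∃ n, p (restrict X n)} := by
  have : {X | ∃ n, p (restrict X n)} = ⋃ σ ∈ {σ | p σ}, cylinder σ := by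
    ext X
    simp only [Set.mem_ofPred_eq, Set.mem_iUnion, exists_prop]
    constructor
    · rintro ⟨n, hn⟩
      exact ⟨_, hn, restrict_mem_cylinder X n⟩
    · rintro ⟨σ, hσ, hX⟩
      have hX' : restrict X σ.length = σ := hX
      exact ⟨σ.length, by rwa [hX']⟩
  rw [this]
  exact MeasurableSet.biUnion (Set.to_countable _) fun σ _ => measurableSet_cylinder σ

/-! ### Approximation of the measure of c.e. open sets -/

/-- The strings of length `n`. -/
def strings : ℕ → List (List Bool)
  | 0 => [[]]
  | n + 1 => (strings n).flatMap fun w => [false :: w, true :: w]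

theorem mem_strings {n : ℕ} {w : List Bool} : w ∈ strings n ↔ w.length = n := by
  induction n generalizing w with
  | zero => simp [strings]
  | succ n ih =>
    simp only [strings, List.mem_flatMap, ih]
    constructor
    · rintro ⟨v, rfl, hw⟩
      simp only [List.mem_cons, List.not_mem_nil, or_false] at hw
      rcases hw with rfl | rfl <;> simp
    · intro h
      cases w with
      | nil => simp at h
      | cons b v => exact ⟨v, by simpa using h, by cases b <;> simp⟩

theorem nodup_strings (n : ℕ) : (strings n).Nodup := by
  induction n with
  | zero => simp [strings]
  | succ n ih =>
    rw [strings, List.nodup_flatMap]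
    refine ⟨fun w _ => by simp, ih.imp fun {a b} hab => ?_⟩
    simp [Function.onFun, List.disjoint_left, hab]

theorem primrec_strings : Primrec strings := by
  have h : Primrec₂ fun (_ : ℕ) (p : ℕ × List (List Bool)) =>
      p.2.flatMap fun w => [false :: w, true :: w] := by
    refine Primrec.list_flatMap (Primrec.snd.comp Primrec.snd) ?_
    exact Primrec.list_cons.comp (Primrec.list_cons.comp (Primrec.const false) Primrec.snd)
      (Primrec.list_cons.comp (Primrec.list_cons.comp (Primrec.const true) Primrec.snd)
        (Primrec.const []))
  refine (Primrec.nat_rec' Primrec.id (Primrec.const [[]]) h).of_eq fun n => ?_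
  induction n with
  | zero => rfl
  | succ n ih =>
    simp only [id] at ih ⊢
    rw [ih, strings]

theorem uniformMeasure_restrict_mem (s : ℕ) (p : List Bool → Bool) :
    uniformMeasure {X | p (restrict X s) = true} =
      ((strings s).filter p).length * (2 : ℝ≥0∞)⁻¹ ^ s := by
  have : {X | p (restrict X s) = true} =
      ⋃ w ∈ ((strings s).filter p).toFinset, cylinder w := by
    ext X
    simp only [Set.mem_ofPred_eq, Set.mem_iUnion, exists_prop, List.mem_toFinset, List.mem_filter,
      mem_strings]
    constructor
    · intro h
      exact ⟨_, ⟨restrict_length X s, h⟩, restrict_mem_cylinder X s⟩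
    · rintro ⟨w, ⟨rfl, hw⟩, hX⟩
      have hX' : restrict X w.length = w := hX
      rwa [hX']
  rw [this, measure_biUnion_finset]
  · rw [Finset.sum_congr rfl (g := fun _ => (2 : ℝ≥0∞)⁻¹ ^ s)]
    · rw [Finset.sum_const, nsmul_eq_mul, List.toFinset_card_of_nodup ((nodup_strings s).filter _)]
    · intro w hw
      rw [uniformMeasure_cylinder]
      simp only [List.mem_toFinset, List.mem_filter, mem_strings] at hw
      rw [hw.1]
  · intro w hw v hv hne
    simp only [List.coe_toFinset, Set.mem_ofPred_eq, List.mem_filter, mem_strings] at hw hv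
    refine Set.disjoint_left.2 fun X hX hX' => hne ?_
    have h1 : restrict X w.length = w := hX
    have h2 : restrict X v.length = v := hX'
    rw [← h1, ← h2, hw.1, hv.1]
  · exact fun w _ => measurableSet_cylinder w

/-- The measure of a c.e. open set is lower semi-computable, uniformly. -/
theorem rePred_lt_mul_measure {β : Type*} [Primcodable β] {B : β → List Bool → Prop}
    (hB : REPred fun x : β × List Bool => B x.1 x.2) :
    REPred fun x : β × ℕ × ℕ =>
      (x.2.1 : ℝ≥0∞) < x.2.2 * uniformMeasure {X | ∃ n, B x.1 (restrict X n)} := by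
  obtain ⟨g, hg, hm, h⟩ := exists_stage_of_rePred hB
  -- Clopen approximation at stage s: a string of length s is accepted if stage s has enumerated one
  -- of its prefixes. The open set is the increasing union of these approximations, and each has
  -- measure (number of accepted strings) · 2^(-s).
  set R : List Bool → β × ℕ → Prop := fun w y => ∃ n < y.2 + 1, g (y.1, w.take n) y.2 = true
    with hR
  have hRp : PrimrecRel R := by
    have h1 : PrimrecRel fun (n : ℕ) (z : List Bool × β × ℕ) =>
        g (z.2.1, z.1.take n) z.2.2 = true := by
      have : Primrec fun y : ℕ × List Bool × β × ℕ => g (y.2.2.1, y.2.1.take y.1) y.2.2.2 := by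
        refine hg.comp (Primrec.pair ?_ ?_) ?_
        · exact Primrec.fst.comp (Primrec.snd.comp Primrec.snd)
        · exact Primrec.list_take.comp Primrec.fst (Primrec.fst.comp Primrec.snd)
        · exact Primrec.snd.comp (Primrec.snd.comp Primrec.snd)
      exact Primrec.eq.comp this (Primrec.const true)
    refine PrimrecPred.of_eq (PrimrecRel.comp
      (f := fun y : List Bool × β × ℕ => List.range (y.2.2 + 1)) (g := fun y => y)
      h1.exists_mem_list (Primrec.list_range.comp
        (Primrec.succ.comp (Primrec.snd.comp Primrec.snd))) Primrec.id) fun y => ?_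
    simp only [List.mem_range, hR]
  classical
  have hcount : Primrec fun y : β × ℕ => ((strings y.2).filter fun w => R w y).length :=
    Primrec.list_length.comp (hRp.listFilter.comp (primrec_strings.comp Primrec.snd) Primrec.id)
  have hdec : ComputablePred fun y : (β × ℕ × ℕ) × ℕ => y.1.2.1 * 2 ^ y.2 <
      y.1.2.2 * ((strings y.2).filter fun w => R w (y.1.1, y.2)).length := by
    refine computablePred_lt (Primrec.nat_mul.to_comp.comp ?_ (computable_two_pow Computable.snd))
      (Primrec.nat_mul.to_comp.comp ?_ ?_)
    · exact Computable.fst.comp (Computable.snd.comp Computable.fst)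
    · exact Computable.snd.comp (Computable.snd.comp Computable.fst)
    · exact hcount.to_comp.comp ((Computable.fst.comp Computable.fst).pair Computable.snd)
  refine (rePred_exists (p := fun (x : β × ℕ × ℕ) (s : ℕ) => x.2.1 * 2 ^ s <
      x.2.2 * ((strings s).filter fun w => R w (x.1, s)).length)
      hdec.to_re).of_eq fun x => ?_
  obtain ⟨b, a, m⟩ := x
  simp only
  have hmono : Monotone fun s => {X | decide (R (restrict X s) (b, s)) = true} := by
    intro s t hst X hX
    simp only [Set.mem_ofPred_eq, decide_eq_true_eq, hR] at hX ⊢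
    obtain ⟨n, hn, hX⟩ := hX
    refine ⟨n, by omega, hm _ s t hst ?_⟩
    rw [restrict_take X (by omega)] at hX ⊢
    exact hX
  have hU : {X | ∃ n, B b (restrict X n)} =
      ⋃ s, {X | decide (R (restrict X s) (b, s)) = true} := by
    ext X
    simp only [Set.mem_ofPred_eq, Set.mem_iUnion, decide_eq_true_eq, hR]
    constructor
    · rintro ⟨n, hn⟩
      obtain ⟨s, hs⟩ := (h (b, restrict X n)).1 hn
      refine ⟨max s n, n, by simp, ?_⟩
      rw [restrict_take X (le_max_right _ _)]
      exact hm _ _ _ (le_max_left _ _) hs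
    · rintro ⟨s, n, hn, hs⟩
      rw [restrict_take X (by omega)] at hs
      exact ⟨n, (h (b, restrict X n)).2 ⟨s, hs⟩⟩
  rw [hU, hmono.measure_iUnion, ENNReal.mul_iSup, lt_iSup_iff]
  refine exists_congr fun s => ?_
  have := uniformMeasure_restrict_mem s fun w => decide (R w (b, s))
  rw [this, ← ENNReal.inv_pow, ← mul_assoc, ← div_eq_mul_inv,
    ENNReal.lt_div_iff_mul_lt (Or.inl (by simp)) (Or.inl (by simp))]
  norm_cast

/-! ### Binary expansions -/

/-- The number with the binary expansion `b 0, …, b (r - 1)`. -/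
def binaryValue (b : ℕ → Bool) (r : ℕ) : ℕ :=
  ∑ i ∈ Finset.range r, (b i).toNat * 2 ^ (r - 1 - i)

theorem decode_eq_binaryValue (r : ℕ → ℕ) (X : ℕ → Bool) (n : ℕ) :
    decode r X n = binaryValue (fun i => X ((∑ j ∈ Finset.range n, r j) + i)) (r n) := rfl

theorem binaryValue_succ (b : ℕ → Bool) (r : ℕ) :
    binaryValue b (r + 1) = 2 * binaryValue b r + (b r).toNat := by
  rw [binaryValue, Finset.sum_range_succ, binaryValue, Finset.mul_sum]
  congr 1
  · refine Finset.sum_congr rfl fun i hi => ?_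
    rw [Finset.mem_range] at hi
    rw [show r + 1 - 1 - i = r - 1 - i + 1 by omega, pow_succ]
    ring
  · simp

theorem binaryValue_congr {b c : ℕ → Bool} {r : ℕ} (h : ∀ i < r, b i = c i) :
    binaryValue b r = binaryValue c r :=
  Finset.sum_congr rfl fun i hi => by rw [h i (Finset.mem_range.1 hi)]

theorem binaryValue_injective {b c : ℕ → Bool} {r : ℕ} (h : binaryValue b r = binaryValue c r) :
    ∀ i < r, b i = c i := by
  induction r with
  | zero => simp
  | succ r ih =>
    rw [binaryValue_succ, binaryValue_succ] at h
    have hb := Bool.toNat_le (b r)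
    have hc := Bool.toNat_le (c r)
    intro i hi
    rcases Nat.lt_succ_iff_lt_or_eq.1 hi with hi | rfl
    · exact ih (by omega) i hi
    · have : (b i).toNat = (c i).toNat := by omega
      revert this
      cases b i <;> cases c i <;> simp

theorem binaryValue_lt_of_padded {b : ℕ → Bool} {s t : ℕ} (h : ∀ i < s, b i = false) :
    binaryValue b (s + t) < 2 ^ t := by
  induction t with
  | zero =>
    rw [add_zero, binaryValue_congr (c := fun _ => false) h]
    simp [binaryValue]
  | succ t ih =>
    rw [← add_assoc, binaryValue_succ, pow_succ]
    have := Bool.toNat_le (b (s + t))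
    omega

theorem exists_binaryValue_eq (s : ℕ) {t v : ℕ} (hv : v < 2 ^ t) :
    ∃ b : ℕ → Bool, (∀ i < s, b i = false) ∧ binaryValue b (s + t) = v := by
  induction t generalizing v with
  | zero =>
    refine ⟨fun _ => false, fun _ _ => rfl, ?_⟩
    have : v = 0 := by simpa using hv
    simp [binaryValue, this]
  | succ t ih =>
    rw [pow_succ] at hv
    obtain ⟨b, hb, hbv⟩ := ih (v := v / 2) (by omega)
    -- The last digit is the parity of `v`; the digits before it expand `v / 2`.
    refine ⟨Function.update b (s + t) (decide (v % 2 = 1)), fun i hi => ?_, ?_⟩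
    · rw [Function.update_of_ne (by omega)]
      exact hb i hi
    · rw [← add_assoc, binaryValue_succ, Function.update_self, binaryValue_congr (c := b), hbv]
      · rcases Nat.mod_two_eq_zero_or_one v with h | h <;> simp [h] <;> omega
      · exact fun i hi => Function.update_of_ne (by omega) _ _

/-- The position at which the `n`-th block starts. -/
def blockStart (r : ℕ → ℕ) (n : ℕ) : ℕ := ∑ j ∈ Finset.range n, r j

theorem blockStart_succ (r : ℕ → ℕ) (n : ℕ) : blockStart r (n + 1) = blockStart r n + r n :=
  Finset.sum_range_succ _ _

theorem blockStart_mono (r : ℕ → ℕ) : Monotone (blockStart r) :=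
  monotone_nat_of_le_succ fun n => by rw [blockStart_succ]; omega

theorem decode_congr {r : ℕ → ℕ} {X Y : ℕ → Bool} {n : ℕ}
    (h : ∀ i < blockStart r (n + 1), X i = Y i) : decode r X n = decode r Y n := by
  rw [blockStart_succ] at h
  exact binaryValue_congr fun i hi => h _ (by simp only [blockStart]; omega)

theorem decode_injective {r : ℕ → ℕ} {X Y : ℕ → Bool} {n : ℕ} (h : decode r X n = decode r Y n) :
    ∀ i ∈ Finset.Ico (blockStart r n) (blockStart r (n + 1)), X i = Y i := by
  intro i hi
  rw [Finset.mem_Ico, blockStart_succ] at hi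
  have := binaryValue_injective h (i - blockStart r n) (by omega)
  have hi' : (∑ j ∈ Finset.range n, r j) + (i - blockStart r n) = i := by
    simp only [blockStart] at hi ⊢
    omega
  simpa only [hi'] using this

/-! ### Random members of `DNC_q` -/

section Random

variable {r s t : ℕ → ℕ} {P : ℕ → Bool}

theorem paddedMeasure_padding_eq_zero (P : ℕ → Bool) :
    paddedMeasure P {X | ∃ i, P i = true ∧ X i = true} = 0 := by
  have : {X : ℕ → Bool | ∃ i, P i = true ∧ X i = true} ⊆
      ⋃ i ∈ {i | P i = true}, {X | ∀ j ∈ ({i} : Finset ℕ), X j = true} := by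
    rintro X ⟨i, hi, hX⟩
    exact Set.mem_biUnion (x := i) hi (by simpa using hX)
  refine measure_mono_null this ((measure_biUnion_null_iff (Set.to_countable _)).2 fun i hi => ?_)
  have hi' : P i = true := hi
  rw [paddedMeasure_box P {i} fun _ => true]
  simp [hi']

/-- The n-th block lies beyond the positions that the box fixes, so it is independent of the box.
Binary expansions are unique, so a value determines all bits of the block, of which `t n` are fair.
Equality can fail, since a value may need a nonzero padding bit or be out of range. -/
theorem paddedMeasure_box_inter_decode_le (hr : ∀ n, r n = s n + t n)
    (hP : ∀ n, ∀ i < r n, P (blockStart r n + i) = true ↔ i < s n) {N n : ℕ} (hN : N ≤ n)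
    (τ : ℕ → Bool) (v : ℕ) :
    paddedMeasure P ({X | ∀ i ∈ Finset.range (blockStart r N), X i = τ i} ∩
      {X | decode r X n = v}) ≤
    paddedMeasure P {X | ∀ i ∈ Finset.range (blockStart r N), X i = τ i} * (2 : ℝ≥0∞)⁻¹ ^ t n := by
  -- A point `Y` of the intersection turns the condition on the value into a condition on bits.
  rcases Set.eq_empty_or_nonempty ({X : ℕ → Bool | ∀ i ∈ Finset.range (blockStart r N), X i = τ i} ∩
      {X | decode r X n = v}) with h | ⟨Y, hY, hYv⟩
  · rw [h, measure_empty]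
    exact zero_le
  have hdisj : Disjoint (Finset.range (blockStart r N))
      (Finset.Ico (blockStart r n) (blockStart r (n + 1))) := by
    refine Finset.disjoint_left.2 fun i hi hi' => ?_
    have := blockStart_mono r hN
    rw [Finset.mem_range] at hi
    rw [Finset.mem_Ico] at hi'
    omega
  have hsub : ({X : ℕ → Bool | ∀ i ∈ Finset.range (blockStart r N), X i = τ i} ∩
      {X | decode r X n = v}) ⊆ {X | ∀ i ∈ Finset.range (blockStart r N) ∪
        Finset.Ico (blockStart r n) (blockStart r (n + 1)), X i = Y i} := by
    rintro X ⟨hX, hXv⟩ i hi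
    rcases Finset.mem_union.1 hi with hi | hi
    · rw [hX i hi, hY i hi]
    · exact decode_injective (Eq.trans hXv (Eq.symm hYv)) i hi
  refine (measure_mono hsub).trans ?_
  rw [paddedMeasure_box, Finset.prod_union hdisj, ← paddedMeasure_box]
  have hset : {X : ℕ → Bool | ∀ i ∈ Finset.range (blockStart r N), X i = Y i} =
      {X | ∀ i ∈ Finset.range (blockStart r N), X i = τ i} := by
    ext X
    exact forall₂_congr fun i hi => by rw [hY i hi]
  rw [hset]
  refine mul_le_mul_right ?_ _
  calc ∏ i ∈ Finset.Ico (blockStart r n) (blockStart r (n + 1)),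
        (bif P i then (bif Y i then 0 else 1) else (2 : ℝ≥0∞)⁻¹)
      ≤ ∏ i ∈ Finset.Ico (blockStart r n) (blockStart r (n + 1)),
        (bif P i then 1 else (2 : ℝ≥0∞)⁻¹) := by
        refine Finset.prod_le_prod' fun i _ => ?_
        cases P i <;> cases Y i <;> simp
    _ = ∏ i ∈ Finset.range (s n + t n), if i < s n then 1 else (2 : ℝ≥0∞)⁻¹ := by
        rw [Finset.prod_Ico_eq_prod_range, blockStart_succ, Nat.add_sub_cancel_left, hr]
        refine Finset.prod_congr rfl fun i hi => ?_
        have := hP n i (by rw [hr]; exact Finset.mem_range.1 hi)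
        by_cases h : i < s n
        · simp [h, this.2 h]
        · have h' : P (blockStart r n + i) = false := by simpa [h] using this
          simp [h, h']
    _ = (2 : ℝ≥0∞)⁻¹ ^ t n := by
        rw [Finset.prod_range_add]
        rw [Finset.prod_eq_one fun i hi => if_pos (Finset.mem_range.1 hi)]
        simp

/-- The padding bits of the prefix have to be 0, since otherwise its cylinder would be a null set.
-/
theorem exists_decode_eq (hr : ∀ n, r n = s n + t n)
    (hP : ∀ n, ∀ i < r n, P (blockStart r n + i) = true ↔ i < s n) {v : ℕ → ℕ}
    (hv : ∀ n, v n < 2 ^ t n) (N : ℕ) :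
    ∃ τ : ℕ → Bool, (∀ n < N, decode r τ n = v n) ∧
      ∀ i < blockStart r N, P i = true → τ i = false := by
  induction N with
  | zero => exact ⟨fun _ => false, by simp, fun _ _ _ => rfl⟩
  | succ N ih =>
    obtain ⟨τ, hτ, hτP⟩ := ih
    obtain ⟨b, hb, hbv⟩ := exists_binaryValue_eq (s N) (hv N)
    refine ⟨fun i => if i < blockStart r N then τ i else b (i - blockStart r N), ?_, ?_⟩
    · intro n hn
      rcases Nat.lt_succ_iff_lt_or_eq.1 hn with hn | rfl
      · rw [← hτ n hn]
        refine decode_congr fun i hi => if_pos (hi.trans_le (blockStart_mono r hn))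
      · rw [← hbv, ← hr, decode_eq_binaryValue]
        refine binaryValue_congr fun i _ => ?_
        rw [← blockStart, if_neg (by omega), Nat.add_sub_cancel_left]
    · intro i hi hPi
      by_cases h : i < blockStart r N
      · simp only [if_pos h]
        exact hτP i h hPi
      · simp only [if_neg h]
        rw [blockStart_succ] at hi
        refine hb _ ((hP N (i - blockStart r N) (by omega)).1 ?_)
        rwa [Nat.add_sub_cancel' (by omega)]

/-- Union bound inside the event that the first N blocks carry fixed admissible values. Finitely
many values cost only a positive factor, and the failures in the tail occupy a proportion of this
event that is less than 1. -/
theorem paddedMeasure_DNC_pos {φ : ℕ → ℕ →. ℕ} {q : ℕ → ℕ} (hr : ∀ n, r n = s n + t n)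
    (hP : ∀ n, ∀ i < r n, P (blockStart r n + i) = true ↔ i < s n) (ht : ∀ n, 2 ^ t n ≤ q n)
    (hJ : ∀ n, ∃ v < 2 ^ t n, v ∉ J φ n) (hsum : ∑' n, (2 : ℝ≥0∞)⁻¹ ^ t n ≠ ∞) :
    0 < paddedMeasure P {X | decode r X ∈ DNC φ q} := by
  choose v hv hvJ using hJ
  obtain ⟨N, hN⟩ : ∃ N, ∑' n, (2 : ℝ≥0∞)⁻¹ ^ t (n + N) < 1 :=
    ((ENNReal.tendsto_sum_nat_add (fun n => (2 : ℝ≥0∞)⁻¹ ^ t n) hsum).eventually_lt_const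
      zero_lt_one).exists
  obtain ⟨τ, hτ, hτP⟩ := exists_decode_eq hr hP hv N
  set E := {X : ℕ → Bool | ∀ i ∈ Finset.range (blockStart r N), X i = τ i} with hE
  have hE0 : paddedMeasure P E ≠ 0 := by
    rw [hE, paddedMeasure_box, Finset.prod_ne_zero_iff]
    intro i hi
    cases h : P i
    · simp
    · simp [hτP i (Finset.mem_range.1 hi) h]
  rw [pos_iff_ne_zero]
  intro h0
  -- Within `E`, membership fails only through a nonzero padding bit, which has probability 0, or
  -- through a hit of J at some place from `N` on. With zero padding the bound `q` holds by itself.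
  have hcover : E ⊆ {X | decode r X ∈ DNC φ q} ∪ {X | ∃ i, P i = true ∧ X i = true} ∪
      ⋃ n, E ∩ {X | decode r X (n + N) ∈ J φ (n + N)} := by
    intro X hX
    by_cases hZ : ∃ i, P i = true ∧ X i = true
    · exact Or.inl (Or.inr hZ)
    by_cases hB : ∃ n, decode r X (n + N) ∈ J φ (n + N)
    · obtain ⟨n, hn⟩ := hB
      exact Or.inr (Set.mem_iUnion.2 ⟨n, hX, hn⟩)
    · refine Or.inl (Or.inl fun n => ⟨?_, ?_⟩)
      · by_cases hn : n < N
        · have : decode r X n = v n := by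
            rw [← hτ n hn]
            exact decode_congr fun i hi =>
              hX i (Finset.mem_range.2 (hi.trans_le (blockStart_mono r hn)))
          rw [this]
          exact hvJ n
        · have := not_exists.1 hB (n - N)
          rwa [Nat.sub_add_cancel (by omega)] at this
      · refine lt_of_lt_of_le ?_ (ht n)
        rw [decode_eq_binaryValue, hr n]
        refine binaryValue_lt_of_padded fun i hi => ?_
        have := (hP n i (by rw [hr]; omega)).2 hi
        by_contra h
        exact hZ ⟨_, this, by simpa [blockStart] using h⟩
  have hbad : ∀ n, paddedMeasure P (E ∩ {X | decode r X (n + N) ∈ J φ (n + N)}) ≤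
      paddedMeasure P E * (2 : ℝ≥0∞)⁻¹ ^ t (n + N) := by
    intro n
    by_cases hd : (J φ (n + N)).Dom
    · refine (measure_mono (Set.inter_subset_inter_right _ fun X hX => ?_)).trans
        (paddedMeasure_box_inter_decode_le hr hP (Nat.le_add_left N n) τ ((J φ (n + N)).get hd))
      exact Part.mem_unique hX (Part.get_mem hd)
    · have : {X | decode r X (n + N) ∈ J φ (n + N)} = ∅ :=
        Set.eq_empty_of_forall_notMem fun X hX => hd (Part.dom_iff_mem.2 ⟨_, hX⟩)
      simp [this]
  have hlt : paddedMeasure P E < paddedMeasure P E := by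
    calc paddedMeasure P E ≤ _ := measure_mono hcover
      _ ≤ 0 + 0 + ∑' n, paddedMeasure P E * (2 : ℝ≥0∞)⁻¹ ^ t (n + N) := by
        refine (measure_union_le _ _).trans (add_le_add ((measure_union_le _ _).trans ?_)
          ((measure_iUnion_le _).trans (ENNReal.tsum_le_tsum hbad)))
        rw [h0, paddedMeasure_padding_eq_zero]
      _ = paddedMeasure P E * ∑' n, (2 : ℝ≥0∞)⁻¹ ^ t (n + N) := by
        rw [ENNReal.tsum_mul_left, add_zero, zero_add]
      _ < paddedMeasure P E * 1 :=
        (ENNReal.mul_lt_mul_iff_right hE0 (measure_ne_top _ _)).2 hN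
      _ = _ := mul_one _
  exact lt_irrefl _ hlt

end Random

/-! ### Computability of the padded measures and the convergent case -/

theorem computable_log {α : Type*} [Primcodable α] {f : α → ℕ} (hf : Computable f) :
    Computable fun a => Nat.log 2 (f a) := by
  refine computable_of_graph ?_
  have h1 : Computable fun p : α × ℕ => f p.1 := hf.comp Computable.fst
  refine (computablePred_and (computablePred_lt h1 (computable_two_pow
    (Computable.succ.comp Computable.snd))) (computablePred_forall_lt
      (p := fun (p : α × ℕ) j => ¬ f p.1 < 2 ^ (j + 1)) (ComputablePred.not (computablePred_lt
        (h1.comp Computable.fst) (computable_two_pow (Computable.succ.comp Computable.snd))))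
      Computable.snd)).of_eq fun p => ?_
  obtain ⟨a, k⟩ := p
  have key : ∀ j, f a < 2 ^ (j + 1) ↔ Nat.log 2 (f a) < j + 1 := fun j =>
    ⟨Nat.log_lt_of_lt_pow' (Nat.succ_ne_zero j), Nat.lt_pow_of_log_lt one_lt_two⟩
  simp only [key]
  constructor
  · rintro ⟨h, h'⟩
    refine le_antisymm (by omega) (not_lt.1 fun hk => h' _ hk (by omega))
  · rintro rfl
    exact ⟨by omega, fun j hj => by omega⟩

theorem computable_clog {α : Type*} [Primcodable α] {f : α → ℕ} (hf : Computable f) :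
    Computable fun a => Nat.clog 2 (f a) := by
  refine computable_of_graph ?_
  have h1 : Computable fun p : α × ℕ => f p.1 := hf.comp Computable.fst
  refine (computablePred_and (computablePred_le h1 (computable_two_pow Computable.snd))
    (computablePred_forall_lt (p := fun (p : α × ℕ) j => ¬ f p.1 ≤ 2 ^ j)
      (ComputablePred.not (computablePred_le
        (h1.comp Computable.fst) (computable_two_pow Computable.snd)))
      Computable.snd)).of_eq fun p => ?_
  obtain ⟨a, k⟩ := p
  simp only [← Nat.clog_le_iff_le_pow one_lt_two]
  constructor
  · rintro ⟨h, h'⟩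
    exact le_antisymm h (not_lt.1 fun hk => h' _ hk le_rfl)
  · rintro rfl
    exact ⟨le_rfl, fun j hj => by omega⟩

theorem computable_blockStart {r : ℕ → ℕ} (hr : Computable r) : Computable (blockStart r) :=
  computable_sum (hr.comp Computable.snd).to₂ Computable.id

/-- A cylinder has measure 0 if its string has a 1 at a padding position, and otherwise 2^(-f) with
f the number of fair positions. This is an exact dyadic value, so the required precision plays no
role. -/
theorem isComputableMeasure_paddedMeasure {P : ℕ → Bool} (hP : Computable P) :
    IsComputableMeasure (paddedMeasure P) := by
  classical
  have hP' : ComputablePred fun i => P i = true := computablePred_eq hP (Computable.const true)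
  have hbit : ComputablePred fun x : (List Bool × ℕ) × ℕ =>
      P x.2 = true ∧ x.1.1.getD x.2 false = true := by
    refine computablePred_and (computablePred_comp hP' Computable.snd)
      (computablePred_eq ?_ (Computable.const true))
    exact (Primrec.list_getD false).to_comp.comp (Computable.fst.comp Computable.fst) Computable.snd
  have hlen : Computable fun x : List Bool × ℕ => x.1.length :=
    Computable.list_length.comp Computable.fst
  refine ⟨fun x => (if ∃ i < x.1.length, P i = true ∧ x.1.getD i false = true then 0 else 1,
    ∑ i ∈ Finset.range x.1.length, if P i = true then 0 else 1), ?_, fun σ i => ?_⟩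
  · refine Computable.pair (computable_ite (computablePred_exists_lt
      (p := fun (x : List Bool × ℕ) i => P i = true ∧ x.1.getD i false = true) hbit hlen)
      (Computable.const 0) (Computable.const 1)) ?_
    exact computable_sum (f := fun _ i => if P i = true then 0 else 1)
      (computable_ite (computablePred_comp hP' Computable.snd)
        (Computable.const 0) (Computable.const 1)).to₂ hlen
  · suffices h : (paddedMeasure P).real (cylinder σ) =
        ((if ∃ i < σ.length, P i = true ∧ σ.getD i false = true then 0 else 1 : ℕ) : ℝ) /
          2 ^ ∑ i ∈ Finset.range σ.length, if P i = true then 0 else 1 by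
      rw [h, sub_self, abs_zero]
      positivity
    rw [cylinder_eq_box, Measure.real, paddedMeasure_box]
    by_cases h : ∃ i < σ.length, P i = true ∧ σ.getD i false = true
    · rw [if_pos h]
      obtain ⟨i, hi, hPi, hσ⟩ := h
      rw [Finset.prod_eq_zero (Finset.mem_range.2 hi)]
      · simp
      · rw [hPi, hσ]
        rfl
    · rw [if_neg h, ENNReal.toReal_prod, Nat.cast_one, ← Finset.prod_pow_eq_pow_sum, one_div,
        ← Finset.prod_inv_distrib]
      refine Finset.prod_congr rfl fun i hi => ?_
      push Not at h
      cases hPi : P i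
      · simp
      · have := h i (Finset.mem_range.1 hi) hPi
        simp only [ne_eq, Bool.not_eq_true] at this
        rw [this]
        simp

/-- Rounding `q n` down to a power of two loses at most a factor 2. -/
theorem tsum_inv_two_pow_log_ne_top {q : ℕ → ℕ} (hq : ∀ n, q n ≠ 0)
    (hs : Summable fun n => 1 / (q n : ℝ)) : ∑' n, (2 : ℝ≥0∞)⁻¹ ^ Nat.log 2 (q n) ≠ ∞ := by
  have h : Summable fun n => (2 : ℝ)⁻¹ ^ Nat.log 2 (q n) := by
    refine Summable.of_nonneg_of_le (fun n => by positivity) (fun n => ?_) (hs.mul_left 2)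
    have h1 : (q n : ℝ) < 2 ^ (Nat.log 2 (q n) + 1) := by
      exact_mod_cast Nat.lt_pow_succ_log_self one_lt_two (q n)
    have h2 : (0 : ℝ) < q n := by exact_mod_cast Nat.pos_of_ne_zero (hq n)
    rw [pow_succ] at h1
    rw [inv_pow, mul_one_div, inv_le_comm₀ (by positivity) (by positivity), inv_div,
      div_le_iff₀ two_pos]
    exact h1.le
  have h2 := h.tsum_ofReal_ne_top
  simp only [ENNReal.ofReal_pow (inv_nonneg.2 zero_le_two), ENNReal.ofReal_inv_of_pos two_pos,
    ENNReal.ofReal_ofNat] at h2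
  exact h2

/-- The class of `q`-bounded diagonally non-computable functions has positive measure for a
computable measure if `∑ 1/q(n)` converges. -/
theorem DNC_random {φ : ℕ → ℕ →. ℕ} {q : ℕ → ℕ} (hq : Computable q) (hq' : IsOrder q)
    (hs : Summable fun n => 1 / (q n : ℝ)) (hne : (DNC φ q).Nonempty) :
    ¬ IsTTNegligible (DNCClass φ q) ∧
      0 < uniformMeasure {X | decode (fun n => Nat.log 2 (q n)) X ∈ DNC φ q} := by
  obtain ⟨f, hf⟩ := hne
  have hq0 : ∀ n, q n ≠ 0 := fun n => by
    have := (hf n).2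
    omega
  have ht : ∀ n, 2 ^ Nat.log 2 (q n) ≤ q n := fun n => Nat.pow_log_le_self 2 (hq0 n)
  -- J(n) has at most one value, so 0 or 1 avoids it when q(n) ≥ 2. When q(n) = 1 the only candidate
  -- is 0, and the given member `f` shows that it is admissible.
  have hJ : ∀ n, ∃ v < 2 ^ Nat.log 2 (q n), v ∉ J φ n := by
    intro n
    rcases Nat.lt_or_ge (q n) 2 with h | h
    · refine ⟨f n, ?_, (hf n).1⟩
      have := (hf n).2
      have : 0 < 2 ^ Nat.log 2 (q n) := by positivity
      omega
    · have h1 : 2 ^ 1 ≤ 2 ^ Nat.log 2 (q n) :=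
        Nat.pow_le_pow_right two_pos (Nat.log_pos one_lt_two h)
      by_cases h0 : 0 ∈ J φ n
      · exact ⟨1, by omega, fun h1 => zero_ne_one (Part.mem_unique h0 h1)⟩
      · exact ⟨0, by omega, h0⟩
  have hsum := tsum_inv_two_pow_log_ne_top hq0 hs
  refine ⟨fun hneg => ?_, ?_⟩
  · set r : ℕ → ℕ := fun n => Nat.clog 2 (q n) with hr
    set s : ℕ → ℕ := fun n => r n - Nat.log 2 (q n) with hsdef
    have hle : ∀ n, Nat.log 2 (q n) ≤ r n := fun n => Nat.log_le_clog _ _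
    have hs1 : ∀ n, s n ≤ 1 := fun n => by
      have : Nat.clog 2 (q n) ≤ Nat.log 2 (q n) + 1 :=
        (Nat.clog_le_iff_le_pow one_lt_two).2 (Nat.lt_pow_succ_log_self one_lt_two _).le
      simp only [hsdef, hr]
      omega
    have hrs : ∀ n, r n = s n + Nat.log 2 (q n) := fun n => by
      have := hle n
      simp only [hsdef]
      omega
    obtain ⟨n₀, hn₀⟩ := hq'.2 1
    -- From `n₀` on q exceeds 1 and no block is empty. Hence a block that starts at i has index at
    -- most i + n₀, which bounds the search for padding positions.
    have hstart : ∀ n, n ≤ blockStart r n + n₀ := by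
      intro n
      induction n with
      | zero => exact Nat.zero_le _
      | succ n ih =>
        rw [blockStart_succ]
        rcases Nat.lt_or_ge n n₀ with h | h
        · omega
        · have : 0 < r n := Nat.clog_pos one_lt_two (lt_of_lt_of_le hn₀ (hq'.1 h))
          omega
    have hrc : Computable r := computable_clog hq
    have hPc : ComputablePred fun i => ∃ n < i + n₀ + 1, s n ≠ 0 ∧ i = blockStart r n := by
      refine computablePred_exists_lt (p := fun i n => s n ≠ 0 ∧ i = blockStart r n)
        (computablePred_and (ComputablePred.not (computablePred_eq ?_ (Computable.const 0)))
          (computablePred_eq Computable.fst ((computable_blockStart hrc).comp Computable.snd)))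
        (Computable.succ.comp (Primrec.nat_add.to_comp.comp Computable.id (Computable.const n₀)))
      exact Primrec.nat_sub.to_comp.comp (hrc.comp Computable.snd)
        ((computable_log hq).comp Computable.snd)
    classical
    set P : ℕ → Bool := fun i => decide (∃ n < i + n₀ + 1, s n ≠ 0 ∧ i = blockStart r n)
    have hP : ∀ n, ∀ i < r n, P (blockStart r n + i) = true ↔ i < s n := by
      intro n i hi
      rw [decide_eq_true_eq]
      constructor
      · rintro ⟨m, -, hm, hmi⟩
        have hrm := hrs m
        rcases lt_trichotomy m n with h | rfl | h
        · have := blockStart_mono r h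
          rw [Nat.succ_eq_add_one, blockStart_succ] at this
          omega
        · omega
        · have := blockStart_mono r h
          rw [Nat.succ_eq_add_one, blockStart_succ] at this
          omega
      · intro h
        have := hs1 n
        have := hstart n
        exact ⟨n, by omega, by omega, by omega⟩
    have hpos := paddedMeasure_DNC_pos hrs hP ht hJ hsum
    exact hpos.ne' (hneg (paddedMeasure P) inferInstance
      (isComputableMeasure_paddedMeasure hPc.decide))
  · exact paddedMeasure_DNC_pos (s := fun _ => 0) (P := fun _ => false)
      (fun n => (zero_add _).symm) (fun n i _ => by simp) ht hJ hsum

/-! ### The universal functional is computably enumerable -/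

theorem computablePred_isPrefix {α : Type*} [Primcodable α] {f g : α → List Bool}
    (hf : Computable f) (hg : Computable g) : ComputablePred fun a => f a <+: g a := by
  refine (computablePred_eq hf (Primrec.list_take.to_comp.comp
    (Computable.list_length.comp hf) hg)).of_eq fun a => ?_
  exact List.prefix_iff_eq_take.symm

theorem computablePred_mem_enumStage :
    ComputablePred fun x : (ℕ × ℕ) × List Bool × List Bool => x.2 ∈ enumStage x.1.1 x.1.2 := by
  have h : Computable fun x : (ℕ × ℕ) × List Bool × List Bool => (Nat.Partrec.Code.evaln x.1.2
      (Nat.Partrec.Code.ofNatCode x.1.1) (Encodable.encode x.2)).isSome := by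
    refine Primrec.to_comp (Primrec.option_isSome.comp (Nat.Partrec.Code.primrec_evaln.comp
      (((Primrec.snd.comp Primrec.fst).pair ((Primrec.ofNat Nat.Partrec.Code).comp
        (Primrec.fst.comp Primrec.fst))).pair (Primrec.encode.comp Primrec.snd))))
  exact computablePred_eq h (Computable.const true)

theorem encode_lt_of_mem_enumStage {e k : ℕ} {p : List Bool × List Bool} (h : p ∈ enumStage e k) :
    Encodable.encode p < k := by
  obtain ⟨x, hx⟩ := Option.isSome_iff_exists.1 (show _ = true from h)
  exact Nat.Partrec.Code.evaln_bound hx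

/-- The pair with code `t`, with a default value if there is none. -/
def pairOfCode (t : ℕ) : List Bool × List Bool := (Encodable.decode t).getD ([], [])

theorem computable_pairOfCode : Computable pairOfCode :=
  Computable.option_getD Computable.decode (Computable.const _)

theorem pairOfCode_encode (p : List Bool × List Bool) : pairOfCode (Encodable.encode p) = p := by
  simp [pairOfCode]

/-- Stage k contains only pairs with code below k, so consistency is a bounded and hence decidable
condition. The default pair of a number that codes nothing is harmless, because membership in the
stage is tested as well. -/
theorem isConsistent_enumStage_iff (e k : ℕ) : IsConsistent (enumStage e k) ↔
    ∀ t < k, ∀ u < k, pairOfCode t ∉ enumStage e k ∨ pairOfCode u ∉ enumStage e k ∨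
      ¬ (pairOfCode t).1 <+: (pairOfCode u).1 ∨
      (pairOfCode t).2 <+: (pairOfCode u).2 ∨ (pairOfCode u).2 <+: (pairOfCode t).2 := by
  constructor
  · intro h t _ u _
    have := h (pairOfCode t)
    have := fun ht => this ht (pairOfCode u)
    tauto
  · intro h p hp p' hp' hpre
    have := h _ (encode_lt_of_mem_enumStage hp) _ (encode_lt_of_mem_enumStage hp')
    rw [pairOfCode_encode, pairOfCode_encode] at this
    tauto

theorem computablePred_isConsistent_enumStage :
    ComputablePred fun x : ℕ × ℕ => IsConsistent (enumStage x.1 x.2) := by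
  refine ComputablePred.of_eq ?_ fun x => (isConsistent_enumStage_iff x.1 x.2).symm
  have ht : Computable fun y : ((ℕ × ℕ) × ℕ) × ℕ => pairOfCode y.1.2 :=
    computable_pairOfCode.comp (Computable.snd.comp Computable.fst)
  have hu : Computable fun y : ((ℕ × ℕ) × ℕ) × ℕ => pairOfCode y.2 :=
    computable_pairOfCode.comp Computable.snd
  have hx : Computable fun y : ((ℕ × ℕ) × ℕ) × ℕ => y.1.1 := Computable.fst.comp Computable.fst
  refine computablePred_forall_lt (p := fun (x : ℕ × ℕ) t => ∀ u < x.2, _)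
    (computablePred_forall_lt (p := fun (x : (ℕ × ℕ) × ℕ) u =>
      pairOfCode x.2 ∉ enumStage x.1.1 x.1.2 ∨ pairOfCode u ∉ enumStage x.1.1 x.1.2 ∨
      ¬ (pairOfCode x.2).1 <+: (pairOfCode u).1 ∨
      (pairOfCode x.2).2 <+: (pairOfCode u).2 ∨ (pairOfCode u).2 <+: (pairOfCode x.2).2) ?_
      (Computable.snd.comp Computable.fst)) Computable.snd
  refine computablePred_or (computablePred_comp computablePred_mem_enumStage (hx.pair ht)).not
    (computablePred_or (computablePred_comp computablePred_mem_enumStage (hx.pair hu)).not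
    (computablePred_or (ComputablePred.not ?_) (computablePred_or ?_ ?_)))
  · exact computablePred_isPrefix (Computable.fst.comp ht) (Computable.fst.comp hu)
  · exact computablePred_isPrefix (Computable.snd.comp ht) (Computable.snd.comp hu)
  · exact computablePred_isPrefix (Computable.snd.comp hu) (Computable.snd.comp ht)

theorem rePred_mem_functional :
    REPred fun x : ℕ × List Bool × List Bool => x.2 ∈ functional x.1 := by
  refine rePred_exists (p := fun (x : ℕ × List Bool × List Bool) k =>
    x.2 ∈ enumStage x.1 k ∧ IsConsistent (enumStage x.1 k)) (ComputablePred.to_re ?_)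
  have h : Computable fun y : (ℕ × List Bool × List Bool) × ℕ => (y.1.1, y.2) :=
    (Computable.fst.comp Computable.fst).pair Computable.snd
  exact computablePred_and (computablePred_comp computablePred_mem_enumStage
    (h.pair (Computable.snd.comp Computable.fst)))
    (computablePred_comp computablePred_isConsistent_enumStage h)

theorem primrec_replicate_true : Primrec fun e : ℕ => List.replicate e true :=
  (Primrec.list_map Primrec.list_range (Primrec.const true).to₂).of_eq fun e => by simp

theorem rePred_mem_universalFunctional :
    REPred fun p : List Bool × List Bool => p ∈ universalFunctional := by
  refine rePred_exists (p := fun (p : List Bool × List Bool) e => ∃ α,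
    p.1 = List.replicate e true ++ false :: α ∧ (α, p.2) ∈ functional e) ?_
  refine rePred_exists (p := fun (x : (List Bool × List Bool) × ℕ) α =>
    x.1.1 = List.replicate x.2 true ++ false :: α ∧ (α, x.1.2) ∈ functional x.2)
    (rePred_and (ComputablePred.to_re (computablePred_eq ?_ ?_)) (rePred_comp rePred_mem_functional
      (f := fun y : ((List Bool × List Bool) × ℕ) × List Bool => (y.1.2, y.2, y.1.1.2)) ?_))
  · exact Computable.fst.comp (Computable.fst.comp Computable.fst)
  · exact Computable.list_append.comp
      (primrec_replicate_true.to_comp.comp (Computable.snd.comp Computable.fst))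
      (Computable.list_cons.comp (Computable.const false) Computable.snd)
  · exact (Computable.snd.comp Computable.fst).pair (Computable.snd.pair
      (Computable.snd.comp (Computable.fst.comp Computable.fst)))

/-- The codes 1^e 0 are prefix-free, so functionals with different indices do not interfere in the
universal one. -/
theorem replicate_append_prefix {e e' : ℕ} {α α' : List Bool}
    (h : List.replicate e true ++ false :: α <+: List.replicate e' true ++ false :: α') :
    e = e' ∧ α <+: α' := by
  induction e generalizing e' with
  | zero =>
    cases e' with
    | zero => simpa using h
    | succ e' => simp [List.replicate_succ] at h
  | succ e ih =>
    cases e' with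
    | zero => simp [List.replicate_succ] at h
    | succ e' =>
      simp only [List.replicate_succ, List.cons_append, List.cons_prefix_cons, true_and] at h
      exact ⟨congrArg (· + 1) (ih h).1, (ih h).2⟩

theorem isConsistent_universalFunctional : IsConsistent universalFunctional := by
  rintro ⟨β, τ⟩ ⟨e, α, hβ, h⟩ ⟨β', τ'⟩ ⟨e', α', hβ', h'⟩ hpre
  simp only at hβ hβ' h h' hpre ⊢
  subst hβ hβ'
  obtain ⟨rfl, hα⟩ := replicate_append_prefix hpre
  exact functional_consistent e _ h _ h' hα

theorem output_comparable {X : ℕ → Bool} {m n : ℕ} {τ τ' : List Bool}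
    (h : (restrict X m, τ) ∈ universalFunctional) (h' : (restrict X n, τ') ∈ universalFunctional) :
    τ <+: τ' ∨ τ' <+: τ := by
  rcases restrict_comparable X m n with hp | hp
  · exact isConsistent_universalFunctional _ h _ h' hp
  · exact (isConsistent_universalFunctional _ h' _ h hp).symm

theorem measurableSet_outputExtends (σ : List Bool) :
    MeasurableSet {X | OutputExtends universalFunctional X σ} := by
  by_cases h : σ = []
  · simp [OutputExtends, h]
  · simp only [OutputExtends, h, false_or]
    exact measurableSet_exists_restrict fun α => ∃ τ, (α, τ) ∈ universalFunctional ∧ σ <+: τ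

/-- The measure of a level of a tree is the probability that `Φ̂` outputs one of its strings. -/
theorem tsum_aprioriM_level (T : Set (List Bool)) (n : ℕ) :
    ∑' σ : level T n, aprioriM σ =
      uniformMeasure {X | ∃ σ ∈ level T n, OutputExtends universalFunctional X σ} := by
  have : {X | ∃ σ ∈ level T n, OutputExtends universalFunctional X σ} =
      ⋃ σ : level T n, {X | OutputExtends universalFunctional X σ} := by
    ext X
    simp
  rw [this, measure_iUnion]
  · rfl
  -- Disjointness: two strings of equal length that extend to comparable outputs are equal. The
  -- empty string, which needs no output, is treated apart.
  · rintro ⟨σ, hσ⟩ ⟨σ', hσ'⟩ hne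
    refine Set.disjoint_left.2 fun X hX hX' => hne (Subtype.ext ?_)
    have hlen : σ.length = σ'.length := hσ.2.trans hσ'.2.symm
    rcases hX with rfl | ⟨m, τ, hτ, hp⟩
    · exact (List.length_eq_zero_iff.1 hlen.symm).symm
    rcases hX' with rfl | ⟨m', τ', hτ', hp'⟩
    · exact List.length_eq_zero_iff.1 hlen
    simp only at hp hp' ⊢
    have : σ <+: σ' ∨ σ' <+: σ := by
      rcases output_comparable hτ hτ' with h | h
      · exact List.prefix_or_prefix_of_prefix (hp.trans h) hp'
      · exact List.prefix_or_prefix_of_prefix hp (hp'.trans h)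
    rcases this with h | h
    · exact h.eq_of_length hlen
    · exact (h.eq_of_length hlen.symm).symm
  · exact fun σ => measurableSet_outputExtends σ

/-! ### Decoding of strings -/

/-- The sequence that continues `τ` by zeros. -/
def extendByZeros (τ : List Bool) (i : ℕ) : Bool := τ.getD i false

theorem mem_cylinder_extendByZeros {τ : List Bool} {X : ℕ → Bool} :
    X ∈ cylinder τ ↔ ∀ i < τ.length, X i = extendByZeros τ i := mem_cylinder_iff

theorem computable_decode {r : ℕ → ℕ} (hr : Computable r) :
    Computable₂ fun (τ : List Bool) (n : ℕ) => decode r (extendByZeros τ) n := by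
  have hr' : Computable fun x : (List Bool × ℕ) × ℕ => r x.1.2 :=
    hr.comp (Computable.snd.comp Computable.fst)
  refine computable_sum (f := fun (x : List Bool × ℕ) i =>
    (extendByZeros x.1 (blockStart r x.2 + i)).toNat * 2 ^ (r x.2 - 1 - i)) ?_
    (hr.comp Computable.snd)
  refine Primrec.nat_mul.to_comp.comp ?_ (computable_two_pow (Primrec.nat_sub.to_comp.comp
    (Primrec.nat_sub.to_comp.comp hr' (Computable.const 1)) Computable.snd))
  refine (Primrec.dom_bool Bool.toNat).to_comp.comp ?_
  exact (Primrec.list_getD false).to_comp.comp (Computable.fst.comp Computable.fst)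
    (Primrec.nat_add.to_comp.comp
      ((computable_blockStart hr).comp (Computable.snd.comp Computable.fst)) Computable.snd)

theorem rePred_mem_J {φ : ℕ → ℕ →. ℕ} (hφ : Partrec₂ φ) :
    REPred fun x : ℕ × ℕ => x.2 ∈ J φ x.1 := by
  have h : REPred fun x : ℕ × ℕ => ∃ e y, x.1 = 2 ^ e * (2 * y + 1) ∧ x.2 ∈ φ e y := by
    refine rePred_exists (p := fun (x : ℕ × ℕ) e => ∃ y, x.1 = 2 ^ e * (2 * y + 1) ∧ x.2 ∈ φ e y)
      (rePred_exists (p := fun (x : (ℕ × ℕ) × ℕ) y =>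
        x.1.1 = 2 ^ x.2 * (2 * y + 1) ∧ x.1.2 ∈ φ x.2 y)
      (rePred_and (ComputablePred.to_re (computablePred_eq ?_ ?_)) (rePred_comp (rePred_mem hφ)
        (f := fun z : ((ℕ × ℕ) × ℕ) × ℕ => (z.1.2, z.2, z.1.1.2)) ?_)))
    · exact Computable.fst.comp (Computable.fst.comp Computable.fst)
    · exact Primrec.nat_mul.to_comp.comp
        (computable_two_pow (Computable.snd.comp Computable.fst))
        (Computable.succ.comp (Primrec.nat_mul.to_comp.comp (Computable.const 2) Computable.snd))
    · exact (Computable.snd.comp Computable.fst).pair (Computable.snd.pair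
        (Computable.snd.comp (Computable.fst.comp Computable.fst)))
  refine h.of_eq fun x => ?_
  obtain ⟨n, v⟩ := x
  constructor
  · rintro ⟨e, y, rfl, hv⟩
    rwa [J_apply]
  · intro hv
    by_cases hn : n = 0
    · simp only [hn, J_zero] at hv
      exact absurd hv (Part.notMem_none _)
    · obtain ⟨e, m, hm, rfl⟩ := Nat.exists_eq_two_pow_mul_odd hn
      obtain ⟨y, rfl⟩ := hm
      exact ⟨e, y, rfl, by rwa [J_apply] at hv⟩

/-- A violation at `n` depends only on the bits up to the end of the n-th block, and it is c.e.:
either a value of J is met or the bound is exceeded. -/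
theorem isPi01_DNCClass {φ : ℕ → ℕ →. ℕ} (hφ : Partrec₂ φ) {q : ℕ → ℕ} (hq : Computable q) :
    IsPi01 (DNCClass φ q) := by
  set r : ℕ → ℕ := fun n => Nat.clog 2 (q n) with hr
  have hrc : Computable r := computable_clog hq
  refine ⟨{σ | ∃ n, blockStart r (n + 1) ≤ σ.length ∧ (decode r (extendByZeros σ) n ∈ J φ n ∨
    q n ≤ decode r (extendByZeros σ) n)}, ?_, ?_⟩
  · refine rePred_exists (p := fun σ n => blockStart r (n + 1) ≤ σ.length ∧
      (decode r (extendByZeros σ) n ∈ J φ n ∨ q n ≤ decode r (extendByZeros σ) n))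
      (rePred_and (ComputablePred.to_re (computablePred_le ?_ ?_)) (rePred_or
        (rePred_comp (rePred_mem_J hφ) (Computable.snd.pair (computable_decode hrc)))
        (ComputablePred.to_re (computablePred_le (hq.comp Computable.snd) (computable_decode hrc)))))
    · exact (computable_blockStart hrc).comp (Computable.succ.comp Computable.snd)
    · exact Computable.list_length.comp Computable.fst
  · ext X
    simp only [Set.mem_compl_iff, Set.mem_iUnion, Set.mem_ofPred_eq, exists_prop]
    constructor
    · intro hX
      have hX' : ¬ ∀ n, decode r X n ∉ J φ n ∧ decode r X n < q n := hX
      rw [not_forall] at hX'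
      obtain ⟨n, hn⟩ := hX'
      refine ⟨restrict X (blockStart r (n + 1)), ⟨n, (restrict_length _ _).ge, ?_⟩,
        restrict_mem_cylinder X _⟩
      have : decode r X n = decode r (extendByZeros (restrict X (blockStart r (n + 1)))) n :=
        decode_congr fun i hi => mem_cylinder_extendByZeros.1 (restrict_mem_cylinder X _) i
          (by rwa [restrict_length])
      rw [← this]
      by_contra h
      push Not at h
      exact hn h
    · rintro ⟨σ, ⟨n, hlen, h⟩, hX⟩ hmem
      have h2 : decode r X n ∉ J φ n ∧ decode r X n < q n := hmem n
      have : decode r X n = decode r (extendByZeros σ) n :=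
        decode_congr fun i hi => mem_cylinder_extendByZeros.1 hX i (hi.trans_le hlen)
      rw [← this] at h
      rcases h with h | h
      · exact h2.1 h
      · omega

/-! ### Diagonalization against a random partial function -/

/-- The argument `x = 2^k (2j+1)` of `φ_e` that serves the `j`-th attack on the `k`-th threshold. -/
def attackInput (k j : ℕ) : ℕ := 2 ^ k * (2 * j + 1)

/-- The argument of `J` that corresponds to `attackInput k j` for the index `e`. -/
def attackNode (e k j : ℕ) : ℕ := 2 ^ e * (2 * attackInput k j + 1)

/-- The argument alone tells φ_e which attack it has to carry out, so attacks on different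
thresholds do not conflict. -/
theorem attackInput_injective {k j k' j' : ℕ} (h : attackInput k j = attackInput k' j') :
    k = k' ∧ j = j' := by
  have key : ∀ k j, padicValNat 2 (attackInput k j) = k := fun k j => by
    rw [attackInput, padicValNat.mul (by positivity) (by positivity), padicValNat.prime_pow,
      padicValNat.eq_zero_of_not_dvd (by omega), add_zero]
  have hk : k = k' := by rw [← key k j, h, key]
  subst hk
  have := Nat.eq_of_mul_eq_mul_left (by positivity) h
  exact ⟨rfl, by omega⟩

theorem attackNode_strictMono (e k : ℕ) : StrictMono (attackNode e k) := by
  intro i j hij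
  have h : attackInput k i < attackInput k j :=
    Nat.mul_lt_mul_of_pos_left (by omega) (by positivity)
  exact Nat.mul_lt_mul_of_pos_left (by omega) (by positivity)

theorem J_attackNode (φ : ℕ → ℕ →. ℕ) (e k j : ℕ) :
    J φ (attackNode e k j) = φ e (attackInput k j) := J_apply φ e _

section Computability

variable {α : Type*} [Primcodable α] {f g h : α → ℕ}

theorem computable_two_pow_mul_odd (hf : Computable f) (hg : Computable g) :
    Computable fun a => 2 ^ f a * (2 * g a + 1) :=
  Primrec.nat_mul.to_comp.comp (computable_two_pow hf)
    (Computable.succ.comp (Primrec.nat_mul.to_comp.comp (Computable.const 2) hg))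

theorem computable_attackInput (hf : Computable f) (hg : Computable g) :
    Computable fun a => attackInput (f a) (g a) := computable_two_pow_mul_odd hf hg

theorem computable_attackNode (hf : Computable f) (hg : Computable g) (hh : Computable h) :
    Computable fun a => attackNode (f a) (g a) (h a) :=
  computable_two_pow_mul_odd hf (computable_attackInput hg hh)

end Computability

/-- On the input `α` the partial function `G` takes the value `b.2.2.2` at the `b.2.2.1`-th attack
node, and differs from `φ` at the earlier ones. -/
def KilledBy (φ : ℕ → ℕ →. ℕ) (G : List Bool → ℕ → ℕ → Prop) (b : ℕ × ℕ × ℕ × ℕ)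
    (α : List Bool) : Prop :=
  G α (attackNode b.1 b.2.1 b.2.2.1) b.2.2.2 ∧ ∀ i < b.2.2.1, ∃ u w,
    G α (attackNode b.1 b.2.1 i) u ∧ w ∈ φ b.1 (attackInput b.2.1 i) ∧ u ≠ w

theorem rePred_killedBy {φ : ℕ → ℕ →. ℕ} (hφ : Partrec₂ φ) {G : List Bool → ℕ → ℕ → Prop}
    (hG : REPred fun x : List Bool × ℕ × ℕ => G x.1 x.2.1 x.2.2) :
    REPred fun x : (ℕ × ℕ × ℕ × ℕ) × List Bool => KilledBy φ G x.1 x.2 := by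
  have he : Computable fun x : (ℕ × ℕ × ℕ × ℕ) × List Bool => x.1.1 :=
    Computable.fst.comp Computable.fst
  have hk : Computable fun x : (ℕ × ℕ × ℕ × ℕ) × List Bool => x.1.2.1 :=
    Computable.fst.comp (Computable.snd.comp Computable.fst)
  have hj : Computable fun x : (ℕ × ℕ × ℕ × ℕ) × List Bool => x.1.2.2.1 :=
    Computable.fst.comp (Computable.snd.comp (Computable.snd.comp Computable.fst))
  have hv : Computable fun x : (ℕ × ℕ × ℕ × ℕ) × List Bool => x.1.2.2.2 :=
    Computable.snd.comp (Computable.snd.comp (Computable.snd.comp Computable.fst))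
  refine rePred_and (rePred_comp hG (f := fun x : (ℕ × ℕ × ℕ × ℕ) × List Bool =>
    (x.2, attackNode x.1.1 x.1.2.1 x.1.2.2.1, x.1.2.2.2))
    (Computable.snd.pair ((computable_attackNode he hk hj).pair hv))) ?_
  refine rePred_forall_lt (p := fun (x : (ℕ × ℕ × ℕ × ℕ) × List Bool) i => ∃ u w,
    G x.2 (attackNode x.1.1 x.1.2.1 i) u ∧ w ∈ φ x.1.1 (attackInput x.1.2.1 i) ∧ u ≠ w) ?_ hj
  refine rePred_exists (p := fun (y : ((ℕ × ℕ × ℕ × ℕ) × List Bool) × ℕ) u => ∃ w,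
    G y.1.2 (attackNode y.1.1.1 y.1.1.2.1 y.2) u ∧
      w ∈ φ y.1.1.1 (attackInput y.1.1.2.1 y.2) ∧ u ≠ w) ?_
  refine rePred_exists (p := fun (z : (((ℕ × ℕ × ℕ × ℕ) × List Bool) × ℕ) × ℕ) w =>
    G z.1.1.2 (attackNode z.1.1.1.1 z.1.1.1.2.1 z.1.2) z.2 ∧
      w ∈ φ z.1.1.1.1 (attackInput z.1.1.1.2.1 z.1.2) ∧ z.2 ≠ w) ?_
  have hx : Computable fun y : ((((ℕ × ℕ × ℕ × ℕ) × List Bool) × ℕ) × ℕ) × ℕ => y.1.1.1 :=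
    Computable.fst.comp (Computable.fst.comp Computable.fst)
  have hi : Computable fun y : ((((ℕ × ℕ × ℕ × ℕ) × List Bool) × ℕ) × ℕ) × ℕ => y.1.1.2 :=
    Computable.snd.comp (Computable.fst.comp Computable.fst)
  have hu : Computable fun y : ((((ℕ × ℕ × ℕ × ℕ) × List Bool) × ℕ) × ℕ) × ℕ => y.1.2 :=
    Computable.snd.comp Computable.fst
  refine rePred_and (rePred_comp hG (f := fun y : ((((ℕ × ℕ × ℕ × ℕ) × List Bool) × ℕ) × ℕ) × ℕ =>
    (y.1.1.1.2, attackNode y.1.1.1.1.1 y.1.1.1.1.2.1 y.1.1.2, y.1.2)) ?_)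
    (rePred_and (rePred_comp (rePred_mem hφ)
      (f := fun y : ((((ℕ × ℕ × ℕ × ℕ) × List Bool) × ℕ) × ℕ) × ℕ =>
        (y.1.1.1.1.1, attackInput y.1.1.1.1.2.1 y.1.1.2, y.2)) ?_)
      (ComputablePred.to_re (ComputablePred.not (computablePred_eq hu Computable.snd))))
  · exact (Computable.snd.comp hx).pair
      ((computable_attackNode (he.comp hx) (hk.comp hx) hi).pair hu)
  · exact (he.comp hx).pair ((computable_attackInput (hk.comp hx) hi).pair Computable.snd)

/-- The event that the random partial function is killed at a given attack node. -/
def killedSet (φ : ℕ → ℕ →. ℕ) (G : List Bool → ℕ → ℕ → Prop) (b : ℕ × ℕ × ℕ × ℕ) :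
    Set (ℕ → Bool) := {X | ∃ n, KilledBy φ G b (restrict X n)}

/-- The event that the random partial function is a `q`-bounded diagonally non-computable function
at the first `m` attack nodes. -/
def survivorSet (φ : ℕ → ℕ →. ℕ) (q : ℕ → ℕ) (G : List Bool → ℕ → ℕ → Prop) (e k m : ℕ) :
    Set (ℕ → Bool) :=
  {X | ∃ l, ∀ j < m, ∃ u < q (attackNode e k j), G (restrict X l) (attackNode e k j) u ∧
    u ∉ J φ (attackNode e k j)}

/-- Some `φ_e` kills, at every attack node, a value of large measure if there is one. -/
theorem exists_killing_index {φ : ℕ → ℕ →. ℕ} (hφ : IsStandardEnumeration φ) {q : ℕ → ℕ}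
    (hq : Computable q) {G : List Bool → ℕ → ℕ → Prop}
    (hG : REPred fun x : List Bool × ℕ × ℕ => G x.1 x.2.1 x.2.2) :
    ∃ e, ∀ k j,
      (∀ v ∈ φ e (attackInput k j), (1 : ℝ≥0∞) <
        (q (attackNode e k j) * 2 ^ k : ℕ) * uniformMeasure (killedSet φ G (e, k, j, v))) ∧
      ((∃ v, (1 : ℝ≥0∞) <
        (q (attackNode e k j) * 2 ^ k : ℕ) * uniformMeasure (killedSet φ G (e, k, j, v))) →
        (φ e (attackInput k j)).Dom) := by
  -- The condition that the killed event has measure above 2^(-k)/q is c.e., because the event is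
  -- c.e. open; it is multiplied out to avoid a division.
  have hR : REPred fun y : (((ℕ × ℕ) × ℕ) × ℕ) × ℕ => y.1.1.1.2 = attackInput y.1.2 y.2 ∧
      (1 : ℝ≥0∞) < (q (attackNode y.1.1.1.1 y.1.2 y.2) * 2 ^ y.1.2 : ℕ) *
        uniformMeasure (killedSet φ G (y.1.1.1.1, y.1.2, y.2, y.1.1.2)) := by
    have hx : Computable fun y : (((ℕ × ℕ) × ℕ) × ℕ) × ℕ => y.1.1.1 :=
      Computable.fst.comp (Computable.fst.comp Computable.fst)
    have he : Computable fun y : (((ℕ × ℕ) × ℕ) × ℕ) × ℕ => y.1.1.1.1 := Computable.fst.comp hx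
    have hv : Computable fun y : (((ℕ × ℕ) × ℕ) × ℕ) × ℕ => y.1.1.2 :=
      Computable.snd.comp (Computable.fst.comp Computable.fst)
    have hk : Computable fun y : (((ℕ × ℕ) × ℕ) × ℕ) × ℕ => y.1.2 :=
      Computable.snd.comp Computable.fst
    refine rePred_and (ComputablePred.to_re (computablePred_eq (Computable.snd.comp hx)
      (computable_attackInput hk Computable.snd))) ?_
    refine (rePred_comp (rePred_lt_mul_measure (rePred_killedBy hφ.1 hG))
      (f := fun y : (((ℕ × ℕ) × ℕ) × ℕ) × ℕ => ((y.1.1.1.1, y.1.2, y.2, y.1.1.2), 1,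
        q (attackNode y.1.1.1.1 y.1.2 y.2) * 2 ^ y.1.2)) ?_).of_eq fun y => ?_
    · refine (he.pair (hk.pair (Computable.snd.pair hv))).pair ((Computable.const 1).pair ?_)
      exact Primrec.nat_mul.to_comp.comp (hq.comp (computable_attackNode he hk Computable.snd))
        (computable_two_pow hk)
    · simp only [Nat.cast_one]
      rfl
  obtain ⟨f, hf, hfR, hfdom⟩ := exists_partrec_selector (α := ℕ × ℕ)
    (R := fun x v => ∃ k j, x.2 = attackInput k j ∧ (1 : ℝ≥0∞) <
      (q (attackNode x.1 k j) * 2 ^ k : ℕ) * uniformMeasure (killedSet φ G (x.1, k, j, v)))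
    (rePred_exists (p := fun (y : (ℕ × ℕ) × ℕ) k => ∃ j, y.1.2 = attackInput k j ∧ (1 : ℝ≥0∞) <
      (q (attackNode y.1.1 k j) * 2 ^ k : ℕ) * uniformMeasure (killedSet φ G (y.1.1, k, j, y.2)))
      (rePred_exists (p := fun (z : ((ℕ × ℕ) × ℕ) × ℕ) j => z.1.1.2 = attackInput z.2 j ∧
        (1 : ℝ≥0∞) < (q (attackNode z.1.1.1 z.2 j) * 2 ^ z.2 : ℕ) *
          uniformMeasure (killedSet φ G (z.1.1.1, z.2, j, z.1.2))) hR))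
  -- The search depends on the index of the function that performs it, since both the nodes and the
  -- earlier kills do; the fixed point closes this circle.
  obtain ⟨e, he⟩ := hφ.fixed_point (ψ := fun e x => f (e, x)) hf.to₂
  refine ⟨e, fun k j => ⟨fun v hv => ?_, fun ⟨v, hv⟩ => ?_⟩⟩
  · rw [he] at hv
    obtain ⟨k', j', hx, h⟩ := hfR _ v hv
    obtain ⟨rfl, rfl⟩ := attackInput_injective hx
    exact h
  · rw [he]
    exact hfdom _ ⟨v, k, j, rfl, hv⟩

/-- If the survivors had measure above 2^(-k), all `m` attacks would succeed, and the disjoint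
killed events would have total measure above 1. `hcons` says that the random object is
single-valued. -/
theorem exists_survivorSet_small {φ : ℕ → ℕ →. ℕ} (hφ : IsStandardEnumeration φ) {q : ℕ → ℕ}
    (hq : Computable q) {G : List Bool → ℕ → ℕ → Prop}
    (hG : REPred fun x : List Bool × ℕ × ℕ => G x.1 x.2.1 x.2.2)
    (hcons : ∀ X m m' n v v', G (restrict X m) n v → G (restrict X m') n v' → v = v') :
    ∃ e, ∀ k m, (2 : ℝ) ^ k ≤ ∑ j ∈ Finset.range m, 1 / (q (attackNode e k j) : ℝ) →
      uniformMeasure (survivorSet φ q G e k m) ≤ (2 : ℝ≥0∞)⁻¹ ^ k := by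
  obtain ⟨e, he⟩ := exists_killing_index hφ hq hG
  refine ⟨e, fun k m hm => ?_⟩
  by_contra hlarge
  rw [not_le] at hlarge
  have hdom : ∀ j < m, (φ e (attackInput k j)).Dom := by
    intro j
    induction j using Nat.strong_induction_on with
    | _ j ih =>
      intro hj
      refine (he k j).2 ?_
      by_contra hsmall
      push Not at hsmall
      -- By induction φ_e is defined at the earlier attacks, and a survivor avoids its values there.
      -- So at the j-th node each survivor meets all conditions of being killed by its own value,
      -- which is one of `q` many.
      have hcover : survivorSet φ q G e k m ⊆
          ⋃ u ∈ Finset.range (q (attackNode e k j)), killedSet φ G (e, k, j, u) := by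
        rintro X ⟨l, hl⟩
        obtain ⟨u, hu, huG, -⟩ := hl j hj
        refine Set.mem_biUnion (x := u) (Finset.mem_coe.2 (Finset.mem_range.2 hu))
          ⟨l, huG, fun i hi => ?_⟩
        obtain ⟨u', -, huG', hJ⟩ := hl i (hi.trans hj)
        refine ⟨u', (φ e (attackInput k i)).get (ih i hi (hi.trans hj)), huG', Part.get_mem _, ?_⟩
        rintro rfl
        rw [J_attackNode] at hJ
        exact hJ (Part.get_mem _)
      -- With no admissible value there are no survivors, against `hlarge`.
      by_cases hq0 : q (attackNode e k j) = 0
      · rw [hq0, Finset.range_zero] at hcover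
        simp only [Finset.notMem_empty, Set.iUnion_of_empty, Set.iUnion_empty,
          Set.subset_empty_iff] at hcover
        simp [hcover] at hlarge
      have hle : (q (attackNode e k j) : ℝ≥0∞) * (2 ^ k *
          uniformMeasure (survivorSet φ q G e k m)) ≤ q (attackNode e k j) * 1 := by
        calc (q (attackNode e k j) : ℝ≥0∞) * (2 ^ k * uniformMeasure (survivorSet φ q G e k m))
            ≤ q (attackNode e k j) * (2 ^ k * ∑ u ∈ Finset.range (q (attackNode e k j)),
              uniformMeasure (killedSet φ G (e, k, j, u))) := by
              gcongr
              exact (measure_mono hcover).trans (measure_biUnion_finset_le _ _)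
          _ = ∑ u ∈ Finset.range (q (attackNode e k j)), (q (attackNode e k j) * 2 ^ k : ℕ) *
              uniformMeasure (killedSet φ G (e, k, j, u)) := by
              rw [← mul_assoc, Finset.mul_sum]
              push_cast
              rfl
          _ ≤ ∑ u ∈ Finset.range (q (attackNode e k j)), 1 :=
              Finset.sum_le_sum fun u _ => hsmall u
          _ = _ := by simp
      rw [ENNReal.mul_le_mul_iff_right (by exact_mod_cast hq0) (ENNReal.natCast_ne_top _)] at hle
      refine hlarge.not_ge ?_
      rw [← ENNReal.inv_pow]
      rw [mul_comm] at hle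
      exact ENNReal.le_inv_iff_mul_le.2 hle
  have hex : ∀ j, ∃ v, j < m → v ∈ φ e (attackInput k j) := fun j => by
    by_cases hj : j < m
    · exact ⟨_, fun _ => Part.get_mem (hdom j hj)⟩
    · exact ⟨0, fun h => absurd h hj⟩
  choose w hwmem using hex
  set V : ℕ → Set (ℕ → Bool) := fun j => killedSet φ G (e, k, j, w j) with hV
  -- An input killed at i has the value `w i` there, whereas one killed at a later j differs from `w
  -- i` at i.
  have hlt : ∀ i j, i < j → j < m → Disjoint (V i) (V j) := by
    intro i j hij hj
    refine Set.disjoint_left.2 fun X hXi hXj => ?_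
    obtain ⟨n, hn, -⟩ := hXi
    obtain ⟨n', -, hn'⟩ := hXj
    obtain ⟨u, v, hu, hv, hne⟩ := hn' i hij
    have : v = w i := Part.mem_unique hv (hwmem i (hij.trans hj))
    exact hne ((hcons X _ _ _ _ _ hu hn).trans this.symm)
  have hdisj : Set.PairwiseDisjoint (Finset.range m : Set ℕ) V := by
    intro i hi j hj hne
    have hi' := Finset.mem_range.1 (Finset.mem_coe.1 hi)
    have hj' := Finset.mem_range.1 (Finset.mem_coe.1 hj)
    rcases lt_or_gt_of_ne hne with h | h
    · exact hlt i j h hj'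
    · exact (hlt j i h hi').symm
  have hsum : ∑ j ∈ Finset.range m, uniformMeasure.real (V j) ≤ 1 := by
    rw [← measureReal_biUnion_finset hdisj fun j _ => measurableSet_exists_restrict _]
    exact measureReal_le_one
  have hVlarge : ∀ j < m, 1 / (q (attackNode e k j) : ℝ) < 2 ^ k * uniformMeasure.real (V j) := by
    intro j hj
    have h1 := (he k j).1 _ (hwmem j hj)
    have h2 : (1 : ℝ) < q (attackNode e k j) * (2 ^ k * uniformMeasure.real (V j)) := by
      have := (ENNReal.toReal_lt_toReal ENNReal.one_ne_top
        (ENNReal.mul_ne_top (ENNReal.natCast_ne_top _) (measure_ne_top _ _))).2 h1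
      rw [ENNReal.toReal_mul, ENNReal.toReal_natCast, ENNReal.toReal_one] at this
      push_cast at this
      rwa [mul_assoc] at this
    have h3 : (0 : ℝ) < q (attackNode e k j) := by
      rcases Nat.eq_zero_or_pos (q (attackNode e k j)) with h | h
      · rw [h] at h2
        norm_num at h2
      · exact_mod_cast h
    rw [div_lt_iff₀ h3]
    linarith
  have hm0 : (Finset.range m).Nonempty := by
    rw [Finset.nonempty_range_iff]
    rintro rfl
    have : (0 : ℝ) < 2 ^ k := by positivity
    simp only [Finset.range_zero, Finset.sum_empty] at hm
    linarith
  have h1 := Finset.sum_lt_sum_of_nonempty hm0 fun j hj => hVlarge j (Finset.mem_range.1 hj)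
  rw [← Finset.mul_sum] at h1
  have h2 := mul_le_mul_of_nonneg_left hsum (show (0 : ℝ) ≤ 2 ^ k by positivity)
  linarith

/-- `Φ̂` maps `α` to a string that decodes to a partial function with value `v` at `n`. -/
def DecodedOutput (r : ℕ → ℕ) (α : List Bool) (n v : ℕ) : Prop :=
  ∃ τ, (α, τ) ∈ universalFunctional ∧ blockStart r (n + 1) ≤ τ.length ∧
    decode r (extendByZeros τ) n = v

theorem rePred_decodedOutput {r : ℕ → ℕ} (hr : Computable r) :
    REPred fun x : List Bool × ℕ × ℕ => DecodedOutput r x.1 x.2.1 x.2.2 := by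
  refine rePred_exists (p := fun (x : List Bool × ℕ × ℕ) τ => (x.1, τ) ∈ universalFunctional ∧
    blockStart r (x.2.1 + 1) ≤ τ.length ∧ decode r (extendByZeros τ) x.2.1 = x.2.2) ?_
  have hn : Computable fun y : (List Bool × ℕ × ℕ) × List Bool => y.1.2.1 :=
    Computable.fst.comp (Computable.snd.comp Computable.fst)
  refine rePred_and (rePred_comp rePred_mem_universalFunctional
    ((Computable.fst.comp Computable.fst).pair Computable.snd))
    (ComputablePred.to_re (computablePred_and (computablePred_le ?_ ?_) (computablePred_eq
      ((computable_decode hr).comp Computable.snd hn) ?_)))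
  · exact (computable_blockStart hr).comp (Computable.succ.comp hn)
  · exact Computable.list_length.comp Computable.snd
  · exact Computable.snd.comp (Computable.snd.comp Computable.fst)

theorem decode_extendByZeros_of_prefix {r : ℕ → ℕ} {σ τ : List Bool} {n : ℕ} (h : σ <+: τ)
    (hn : blockStart r (n + 1) ≤ σ.length) :
    decode r (extendByZeros σ) n = decode r (extendByZeros τ) n := by
  refine decode_congr fun i hi => ?_
  obtain ⟨ρ, rfl⟩ := h
  simp only [extendByZeros]
  rw [List.getD_append _ _ _ _ (hi.trans_le hn)]

theorem decodedOutput_unique {r : ℕ → ℕ} (X : ℕ → Bool) (m m' n v v' : ℕ)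
    (h : DecodedOutput r (restrict X m) n v) (h' : DecodedOutput r (restrict X m') n v') :
    v = v' := by
  obtain ⟨τ, hτ, hlen, rfl⟩ := h
  obtain ⟨τ', hτ', hlen', rfl⟩ := h'
  rcases output_comparable hτ hτ' with h | h
  · exact decode_extendByZeros_of_prefix h hlen
  · exact (decode_extendByZeros_of_prefix h hlen').symm

/-- An output of `Φ̂` that lies on the canonical tree of `DNC_q` survives all attacks. -/
theorem outputExtends_subset_survivorSet {φ : ℕ → ℕ →. ℕ} {q : ℕ → ℕ} {e k m N : ℕ} (hN : 0 < N)
    (hm : ∀ j < m, blockStart (fun n => Nat.clog 2 (q n)) (attackNode e k j + 1) ≤ N) :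
    {X | ∃ σ ∈ level (canonicalTree (DNCClass φ q)) N, OutputExtends universalFunctional X σ} ⊆
      survivorSet φ q (DecodedOutput fun n => Nat.clog 2 (q n)) e k m := by
  rintro X ⟨σ, ⟨⟨Y, hYσ, hY⟩, rfl⟩, hX⟩
  rcases hX with rfl | ⟨l, τ, hτ, hp⟩
  · simp at hN
  -- A single output `τ` serves all attack nodes: their blocks lie within `σ`, where `τ` agrees with
  -- the member `Y` of the class.
  refine ⟨l, fun j hj => ⟨_, (hY _).2, ⟨τ, hτ, (hm j hj).trans hp.length_le, ?_⟩, (hY _).1⟩⟩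
  rw [← decode_extendByZeros_of_prefix hp (hm j hj)]
  exact (decode_congr fun i hi =>
    mem_cylinder_extendByZeros.1 hYσ i (hi.trans_le (hm j hj))).symm

/-! ### Divergence along attack nodes -/

/-- The nodes form an arithmetic progression with difference 2^(e+k+2). For a non-increasing
sequence, the series over one residue class diverges if the whole series does. -/
theorem not_summable_attackNode {q : ℕ → ℕ} (hq : Monotone q) (hq0 : ∀ n, q n ≠ 0)
    (hs : ¬ Summable fun n => 1 / (q n : ℝ)) (e k : ℕ) :
    ¬ Summable fun j => 1 / (q (attackNode e k j) : ℝ) := by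
  have hanti : Antitone fun n => 1 / (q n : ℝ) := fun a b hab => by
    have h1 : (0 : ℝ) < q a := by exact_mod_cast Nat.pos_of_ne_zero (hq0 a)
    exact one_div_le_one_div_of_le h1 (by exact_mod_cast hq hab)
  have aux : ∀ d c : ℕ, d ≠ 0 → ¬ Summable fun j => 1 / (q (d * j + c) : ℝ) := by
    intro d c hd
    have : NeZero d := ⟨hd⟩
    rwa [← summable_indicator_mod_iff_summable d c fun n => 1 / (q n : ℝ),
      summable_indicator_mod_iff hanti]
  have h : ∀ j, attackNode e k j = 2 ^ (e + k + 2) * j + (2 ^ (e + k + 1) + 2 ^ e) := fun j => by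
    rw [attackNode, attackInput]
    ring
  simpa only [h] using aux _ _ (by positivity)

theorem exists_computable_attackCount {q : ℕ → ℕ} (hqc : Computable q) (hq : Monotone q)
    (hq0 : ∀ n, q n ≠ 0) (hs : ¬ Summable fun n => 1 / (q n : ℝ)) (e : ℕ) :
    ∃ m : ℕ → ℕ, Computable m ∧
      ∀ k, (2 : ℝ) ^ k ≤ ∑ j ∈ Finset.range (m k), 1 / (q (attackNode e k j) : ℝ) := by
  -- `D` is a common denominator. Multiplied by it, the inequality between reals becomes one between
  -- natural numbers, with exact divisions, and is decidable; divergence makes the search for `m`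
  -- succeed.
  set D : ℕ × ℕ → ℕ := fun x => ∏ j ∈ Finset.range x.2, q (attackNode e x.1 j) with hD
  have hqn : Computable₂ fun (x : ℕ × ℕ) (j : ℕ) => q (attackNode e x.1 j) :=
    hqc.comp (computable_attackNode (Computable.const e) (Computable.fst.comp Computable.fst)
      Computable.snd)
  have hDc : Computable D := computable_prod hqn Computable.snd
  have key : ∀ k m, 2 ^ k * D (k, m) ≤ ∑ j ∈ Finset.range m, D (k, m) / q (attackNode e k j) ↔
      (2 : ℝ) ^ k ≤ ∑ j ∈ Finset.range m, 1 / (q (attackNode e k j) : ℝ) := by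
    intro k m
    have hDpos : (0 : ℝ) < D (k, m) := by
      have : D (k, m) ≠ 0 := Finset.prod_ne_zero_iff.2 fun j _ => hq0 _
      exact_mod_cast Nat.pos_of_ne_zero this
    rw [← mul_le_mul_iff_left₀ hDpos, Finset.sum_mul, ← Nat.cast_le (α := ℝ)]
    push_cast
    rw [Finset.sum_congr rfl fun j hj => ?_]
    rw [Nat.cast_div (Finset.dvd_prod_of_mem (fun j => q (attackNode e k j)) hj)
      (by exact_mod_cast hq0 _)]
    ring
  obtain ⟨m, hm, h⟩ := exists_computable_witness
    (p := fun k m => 2 ^ k * D (k, m) ≤ ∑ j ∈ Finset.range m, D (k, m) / q (attackNode e k j))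
    (computablePred_le (Primrec.nat_mul.to_comp.comp (computable_two_pow Computable.fst) hDc)
      (computable_sum (f := fun (x : ℕ × ℕ) j => D x / q (attackNode e x.1 j))
        (Primrec.nat_div.to_comp.comp (hDc.comp Computable.fst) hqn)
        Computable.snd)) fun k => by
      have htop := (not_summable_iff_tendsto_nat_atTop_of_nonneg fun j => by positivity).1
        (not_summable_attackNode hq hq0 hs e k)
      obtain ⟨m, hm⟩ := (htop.eventually_ge_atTop ((2 : ℝ) ^ k)).exists
      exact ⟨m, (key k m).2 hm⟩
  exact ⟨m, hm, fun k => (key k (m k)).1 (h k)⟩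

/-- A computable bound on where a bound is attained turns into a computable order. -/
theorem exists_order_of_thresholds {L : ℕ → ℕ} (hL : Computable L) :
    ∃ h : ℕ → ℕ, Computable h ∧ IsOrder h ∧ ∀ n, h n = 0 ∨ L (h n) ≤ n := by
  set S : ℕ → ℕ := fun k => ∑ i ∈ Finset.range (k + 1), L i with hS
  have hSc : Computable S := computable_sum (hL.comp Computable.snd).to₂ Computable.succ
  -- The cut-off at `n` keeps the search finite. If no positive k qualifies, the result is the
  -- default 0, whence the first alternative.
  refine ⟨fun n => Nat.findGreatest (fun k => S k ≤ n) n, ?_, ⟨?_, fun b => ?_⟩, fun n => ?_⟩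
  · exact computable_findGreatest (p := fun n k => S k ≤ n)
      (computablePred_le (hSc.comp Computable.snd) Computable.fst) Computable.id
  · exact fun a b hab => Nat.findGreatest_mono (fun k hk => le_trans hk hab) hab
  · refine ⟨max (S (b + 1)) (b + 1), lt_of_lt_of_le (Nat.lt_succ_self b)
      (Nat.le_findGreatest (le_max_right _ _) (le_max_left _ _))⟩
  · by_cases h : Nat.findGreatest (fun k => S k ≤ n) n = 0
    · exact Or.inl h
    · refine Or.inr (le_trans ?_ (Nat.findGreatest_of_ne_zero (P := fun k => S k ≤ n) rfl h))
      exact Finset.single_le_sum (f := L) (fun _ _ => Nat.zero_le _)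
        (Finset.mem_range.2 (Nat.lt_succ_self _))

/-- `DNC_q` is deep if `∑ 1/q(n)` diverges. -/
theorem isDeep_DNCClass {φ : ℕ → ℕ →. ℕ} (hφ : IsStandardEnumeration φ) {q : ℕ → ℕ}
    (hqc : Computable q) (hq : Monotone q) (hs : ¬ Summable fun n => 1 / (q n : ℝ)) :
    IsDeep (DNCClass φ q) := by
  refine ⟨isPi01_DNCClass hφ.1 hqc, ?_⟩
  -- A zero of `q` makes the class and all levels empty, so any computable order will do.
  by_cases hq0 : ∃ n, q n = 0
  · obtain ⟨n₀, hn₀⟩ := hq0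
    have hempty : ∀ n, level (canonicalTree (DNCClass φ q)) n = ∅ := fun n =>
      Set.eq_empty_of_forall_notMem fun σ hσ => by
        obtain ⟨⟨Y, -, hY⟩, -⟩ := hσ
        have := (hY n₀).2
        omega
    refine ⟨id, Computable.id, ⟨monotone_id, fun b => ⟨b + 1, Nat.lt_succ_self b⟩⟩, fun n => ?_⟩
    rw [tsum_aprioriM_level, hempty]
    simp
  push Not at hq0
  set r : ℕ → ℕ := fun n => Nat.clog 2 (q n) with hr
  have hrc : Computable r := computable_clog hqc
  obtain ⟨e, he⟩ := exists_survivorSet_small hφ hqc (rePred_decodedOutput hrc)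
    decodedOutput_unique
  obtain ⟨m, hm, hmk⟩ := exists_computable_attackCount hqc hq hq0 hs e
  -- At length `L k` the blocks of the first `m k` attack nodes are complete, as the next node lies
  -- beyond them. The added 1 excludes level 0, where the empty string counts as an output of every
  -- input.
  obtain ⟨h, hc, ho, hle⟩ := exists_order_of_thresholds
    (L := fun k => blockStart r (attackNode e k (m k)) + 1)
    (Computable.succ.comp ((computable_blockStart hrc).comp
      (computable_attackNode (Computable.const e) Computable.id hm)))
  refine ⟨h, hc, ho, fun n => ?_⟩
  rw [tsum_aprioriM_level]
  rcases hle n with h0 | hn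
  · rw [h0, pow_zero]
    exact prob_le_one
  · refine (measure_mono (outputExtends_subset_survivorSet (by omega) fun j hj => ?_)).trans
      (he (h n) (m (h n)) (hmk _))
    exact (blockStart_mono r (attackNode_strictMono e _ hj)).trans (by omega)

end DNCDepth

theorem mainTheorem8 (φ : ℕ → ℕ →. ℕ) (hφ : DNCDepth.IsStandardEnumeration φ)
    (q : ℕ → ℕ) (hq : Computable q) (hq' : DNCDepth.IsOrder q) :
    (Summable (fun n => 1 / (q n : ℝ)) → (DNCDepth.DNC φ q).Nonempty →
      ¬ DNCDepth.IsTTNegligible (DNCDepth.DNCClass φ q) ∧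
      0 < DNCDepth.uniformMeasure
        {X | DNCDepth.decode (fun n => Nat.log 2 (q n)) X ∈ DNCDepth.DNC φ q}) ∧
    (¬ Summable (fun n => 1 / (q n : ℝ)) →
      DNCDepth.IsDeep (DNCDepth.DNCClass φ q)) :=
  ⟨fun hs hne => DNCDepth.DNC_random hq hq' hs hne,
    fun hs => DNCDepth.isDeep_DNCClass hφ hq hq'.1 hs⟩
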